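/- Let $\ell>0$, $m\in\mathbb R$, $\alpha\in(0,\pi)$ (a Robin condition at $z=0$), and let $\beta_1,\beta_2,\beta_1',\beta_2'\in\mathbb R$ satisfy $\rho:=\beta_1'\beta_2-\beta_1\beta_2'>0$. Let $\mathcal H=L^2((0,\ell))\oplus\mathbb C$ with inner product $$(\varphi,\chi)_{\mathcal H}=\int_0^\ell\overline{\varphi_1(z)}\,\chi_1(z)\,dz+\rho^{-1}\,\overline{\varphi_2}\,\chi_2 ,$$ and let $A$ be the operator in $\mathcal H$ given by $$A\varphi=\begin{pmatrix}-\partial_z^2\varphi_1+m^2\varphi_1\\ -[\beta_1\varphi_1(\ell)-\beta_2\,\partial_z\varphi_1(\ell)]\end{pmatrix}$$ on the domain $D(A)$ of all $\varphi=(\varphi_1,\varphi_2)^\top\in\mathcal H$ such that $\varphi_1,\partial_z\varphi_1$ are absolutely continuous on $[0,\ell]$, $\partial_z^2\varphi_1\in L^2((0,\ell))$, $\cos\alpha\,\varphi_1(0)+\sin\alpha\,\partial_z\varphi_1(0)=0$ and $\varphi_2=\beta_1'\varphi_1(\ell)-\beta_2'\,\partial_z\varphi_1(\ell)$. This operator is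 self-adjoint with discrete spectrum. Assume that $A>0$, that is, $(\varphi,A\varphi)_{\mathcal H}>0$ for all $0\ne\varphi\in D(A)$. Functions of $A$ are defined by $g(A)=\sum_\lambda g(\lambda)P_\lambda$, where $\lambda$ runs over the eigenvalues of $A$ and $P_\lambda$ is the orthogonal projection onto the eigenspace of $\lambda$. Let $f\in C_{0,R}(\mathbb R,D(\sqrt A))$, that is, $f$ is a compactly supported continuous function from $\mathbb R$ to $D(\sqrt A)$, equipped with the graph norm $\|\varphi\|_{\mathcal H}+\|\sqrt A\varphi\|_{\mathcal H}$, whose values have real-valued components. Put $$\phi_f^{\rm R}(t)=(E_{\rm R}f)(t)=-\int_{\mathbb R}\frac{\sin\big(\sqrt A\,(t-t')\big)}{\sqrt A}\,f(t')\,dt'\in\mathcal H .$$ Then $\phi_f^{\rm R}$ is continuously differentiable in $t$ and $z$, with derivatives uniformly bounded for $t\in\mathbb R$ and $z\in[0,\ell]$. Precisely, $\phi_f^{\rm R}(t)=((\phi_f^{\rm R})_1(t,\cdot),(\phi_f^{\rm R})_2(t))$ for all $t$, where $(\phi_f^{\rm R})_1$ has partial derivatives $\partial_t(\phi_f^{\rm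 R})_1$ and $\partial_z(\phi_f^{\rm R})_1$ at every point of $\mathbb R\times[0,\ell]$ (one-sided in $z$ at $z=0,\ell$), both jointly continuous and bounded on $\mathbb R\times[0,\ell]$, and $(\phi_f^{\rm R})_2$ is continuously differentiable on $\mathbb R$ with bounded derivative. -/

import Mathlib

open MeasureTheory Set
open scoped ComplexConjugate

noncomputable section

namespace DynBC

/-- The parameters of the system on `[0, ℓ]`: the length, the mass, the angle of the boundary
condition at `z = 0`, and the coefficients `β₁, β₂, β₁', β₂'` of the dynamical boundary condition
at `z = ℓ`, whose determinant `ρ = β₁' β₂ - β₁ β₂'` is positive. -/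
structure Params where
  ℓ : ℝ
  m : ℝ
  α : ℝ
  β₁ : ℝ
  β₂ : ℝ
  β₁' : ℝ
  β₂' : ℝ
  ℓ_pos : 0 < ℓ
  α_mem : α ∈ Ico 0 Real.pi
  ρ_pos : 0 < β₁' * β₂ - β₁ * β₂'

/-- The determinant `ρ`. -/
def Params.ρ (p : Params) : ℝ := p.β₁' * p.β₂ - p.β₁ * p.β₂'

/-- Lebesgue measure on `(0, ℓ)`. -/
def Params.μ (p : Params) : Measure ℝ := volume.restrict (Ioo 0 p.ℓ)

/-! ### The Hilbert space `𝓗 = L²((0,ℓ)) ⊕ ℂ` -/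

/-- The boundary component of `𝓗`: the space `ℂ` with the inner product `ρ⁻¹ * conj x * y`. -/
def BoundarySpace (_p : Params) : Type := ℂ

instance (p : Params) : AddCommGroup (BoundarySpace p) := inferInstanceAs (AddCommGroup ℂ)

instance (p : Params) : Module ℂ (BoundarySpace p) := inferInstanceAs (Module ℂ ℂ)

/-- The complex number behind an element of the boundary component. -/
def BoundarySpace.val {p : Params} : BoundarySpace p →ₗ[ℂ] ℂ := (LinearMap.id : ℂ →ₗ[ℂ] ℂ)

/-- The weighted inner product on the boundary component. -/
@[reducible]
def BoundarySpace.core (p : Params) : InnerProductSpace.Core ℂ (BoundarySpace p) where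
  inner x y := (p.ρ : ℂ)⁻¹ * (conj x.val * y.val)
  conj_inner_symm x y := by
    simp only [map_mul, map_inv₀, Complex.conj_ofReal, Complex.conj_conj]
    ring
  re_inner_nonneg x := by
    have hρ : (0 : ℝ) < p.ρ := p.ρ_pos
    rw [← Complex.normSq_eq_conj_mul_self, ← Complex.ofReal_inv, ← Complex.ofReal_mul]
    simpa using mul_nonneg (inv_nonneg.mpr hρ.le) (Complex.normSq_nonneg x.val)
  add_left x y z := by
    simp only [map_add]
    ring
  smul_left x y r := by
    simp only [map_smul, smul_eq_mul, map_mul]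
    ring
  definite x h := by
    have hρ : p.ρ ≠ 0 := ne_of_gt p.ρ_pos
    rw [← Complex.normSq_eq_conj_mul_self] at h
    have h1 : Complex.normSq x.val = 0 := by
      rcases mul_eq_zero.mp h with h | h
      · exact absurd (by simpa using h) hρ
      · exact_mod_cast h
    exact Complex.normSq_eq_zero.mp h1

instance (p : Params) : NormedAddCommGroup (BoundarySpace p) :=
  @InnerProductSpace.Core.toNormedAddCommGroup ℂ (BoundarySpace p) _ _ _ (BoundarySpace.core p)

instance (p : Params) : InnerProductSpace ℂ (BoundarySpace p) :=
  InnerProductSpace.ofCore (BoundarySpace.core p).toCore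

instance (p : Params) : FiniteDimensional ℂ (BoundarySpace p) :=
  inferInstanceAs (FiniteDimensional ℂ ℂ)

instance (p : Params) : CompleteSpace (BoundarySpace p) := FiniteDimensional.complete ℂ _

/-- The Hilbert space `𝓗 = L²((0,ℓ)) ⊕ ℂ`, with the inner product
`(φ, χ) = ∫_0^ℓ conj (φ₁ z) * χ₁ z dz + ρ⁻¹ * conj φ₂ * χ₂`. -/
abbrev H (p : Params) : Type := WithLp 2 (Lp ℂ 2 p.μ × BoundarySpace p)

/-- The bulk component `φ₁` of `φ`. -/
def bulk {p : Params} (φ : H p) : Lp ℂ 2 p.μ := φ.fst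

/-- The boundary component `φ₂` of `φ`. -/
def bdry {p : Params} (φ : H p) : ℂ := φ.snd.val

theorem inner_eq {p : Params} (φ χ : H p) :
    inner ℂ φ χ = (∫ z in (0 : ℝ)..p.ℓ, conj (bulk φ z) * bulk χ z) +
      (p.ρ : ℂ)⁻¹ * (conj (bdry φ) * bdry χ) := by
  rw [WithLp.prod_inner_apply, MeasureTheory.L2.inner_def,
    intervalIntegral.integral_of_le p.ℓ_pos.le, integral_Ioc_eq_integral_Ioo]
  congr 1
  refine integral_congr_ae (Filter.Eventually.of_forall fun z => ?_)
  exact mul_comm _ _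

/-! ### The operator `A` -/

/-- `φ ∈ D(A)` and `χ = A φ`. Here `u` is the continuous representative of `φ₁`, `v = u'` on
`[0, ℓ]`, and `w = u''` almost everywhere. -/
def IsGraph (p : Params) (φ χ : H p) : Prop :=
  ∃ u v w : ℝ → ℂ,
    bulk φ =ᵐ[p.μ] u ∧
    AbsolutelyContinuousOnInterval u 0 p.ℓ ∧
    AbsolutelyContinuousOnInterval v 0 p.ℓ ∧
    (∀ z ∈ Icc 0 p.ℓ, HasDerivWithinAt u (v z) (Icc 0 p.ℓ) z) ∧
    (∀ᵐ z ∂p.μ, HasDerivAt v (w z) z) ∧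
    MemLp w 2 p.μ ∧
    (Real.cos p.α : ℂ) * u 0 + (Real.sin p.α : ℂ) * v 0 = 0 ∧
    bdry φ = p.β₁' * u p.ℓ - p.β₂' * v p.ℓ ∧
    bulk χ =ᵐ[p.μ] (fun z => -w z + (p.m : ℂ) ^ 2 * u z) ∧
    bdry χ = -(p.β₁ * u p.ℓ - p.β₂ * v p.ℓ)

/-- The graph of `A`. -/
def graphA (p : Params) : Submodule ℂ (H p × H p) where
  carrier := {x | IsGraph p x.1 x.2}
  add_mem' := by
    rintro ⟨φ, χ⟩ ⟨φ', χ'⟩ ⟨u, v, w, h1, h2, h3, h4, h5, h6, h7, h8, h9, h10⟩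
      ⟨u', v', w', k1, k2, k3, k4, k5, k6, k7, k8, k9, k10⟩
    refine ⟨u + u', v + v', w + w', ?_, h2.add k2, h3.add k3, fun z hz => (h4 z hz).add (k4 z hz),
      ?_, h6.add k6, ?_, ?_, ?_, ?_⟩
    · filter_upwards [Lp.coeFn_add (bulk φ) (bulk φ'), h1, k1] with z a b c
      change (bulk φ + bulk φ') z = _
      rw [a, Pi.add_apply, Pi.add_apply, b, c]
    · filter_upwards [h5, k5] with z a b using a.add b
    · simp only [Pi.add_apply]
      linear_combination h7 + k7
    · change bdry φ + bdry φ' = _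
      simp only [Pi.add_apply]
      linear_combination h8 + k8
    · filter_upwards [Lp.coeFn_add (bulk χ) (bulk χ'), h9, k9] with z a b c
      change (bulk χ + bulk χ') z = _
      rw [a, Pi.add_apply, b, c, Pi.add_apply, Pi.add_apply]
      ring
    · change bdry χ + bdry χ' = _
      simp only [Pi.add_apply]
      linear_combination h10 + k10
  zero_mem' := by
    have hac : AbsolutelyContinuousOnInterval (fun _ : ℝ => (0 : ℂ)) 0 p.ℓ :=
      (LipschitzOnWith.absolutelyContinuousOnInterval (K := 0)
        (LipschitzWith.const (0 : ℂ)).lipschitzOnWith)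
    refine ⟨fun _ => 0, fun _ => 0, fun _ => 0, Lp.coeFn_zero _ _ _, hac, hac,
      fun z _ => hasDerivWithinAt_const _ _ _,
      Filter.Eventually.of_forall fun z => hasDerivAt_const _ _, MemLp.zero, by simp, ?_, ?_, ?_⟩
    · change (0 : ℂ) = _
      simp
    · filter_upwards [Lp.coeFn_zero ℂ 2 p.μ] with z hz
      change (0 : Lp ℂ 2 p.μ) z = _
      rw [hz]
      simp
    · change (0 : ℂ) = _
      simp
  smul_mem' := by
    rintro c ⟨φ, χ⟩ ⟨u, v, w, h1, h2, h3, h4, h5, h6, h7, h8, h9, h10⟩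
    refine ⟨fun z => c • u z, fun z => c • v z, fun z => c • w z, ?_, h2.const_smul c,
      h3.const_smul c, fun z hz => (h4 z hz).const_smul c, ?_, h6.const_smul c, ?_, ?_, ?_, ?_⟩
    · filter_upwards [Lp.coeFn_smul c (bulk φ), h1] with z a b
      change (c • bulk φ) z = _
      rw [a, Pi.smul_apply, b]
    · filter_upwards [h5] with z a using a.const_smul c
    · simp only [smul_eq_mul]
      linear_combination c * h7
    · change c * bdry φ = _
      simp only [smul_eq_mul]
      linear_combination c * h8
    · filter_upwards [Lp.coeFn_smul c (bulk χ), h9] with z a b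
      change (c • bulk χ) z = _
      rw [a, Pi.smul_apply, b]
      simp only [smul_eq_mul]
      ring
    · change c * bdry χ = _
      simp only [smul_eq_mul]
      linear_combination c * h10

/-- The unbounded operator `A` in `𝓗`, for the potential `V = 0`. -/
def opA (p : Params) : H p →ₗ.[ℂ] H p := (graphA p).toLinearPMap

/-- `A` is well defined: its graph is the relation `IsGraph`. -/
theorem mem_graph_opA {p : Params} (φ χ : H p) : (φ, χ) ∈ (opA p).graph ↔ IsGraph p φ χ := by
  have key : (opA p).graph = graphA p := by
    refine Submodule.toLinearPMap_graph_eq _ ?_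
    rintro ⟨φ, χ⟩ ⟨u, v, w, h1, h2, h3, h4, h5, h6, h7, h8, h9, h10⟩ h0
    simp only at h0 h1 h9 h10
    subst h0
    have hℓ := p.ℓ_pos
    have hu0 : u =ᵐ[p.μ] fun _ => (0 : ℂ) := by
      filter_upwards [h1, Lp.coeFn_zero ℂ 2 p.μ] with z a b
      rw [← a]
      exact b
    have hcont : ContinuousOn u (Icc 0 p.ℓ) := fun z hz => (h4 z hz).continuousWithinAt
    have hIoo : EqOn u (fun _ => 0) (Ioo 0 p.ℓ) :=
      Measure.eqOn_open_of_ae_eq hu0 isOpen_Ioo (hcont.mono Ioo_subset_Icc_self)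
        continuousOn_const
    have hu : EqOn u (fun _ => 0) (Icc 0 p.ℓ) :=
      hIoo.of_subset_closure hcont continuousOn_const Ioo_subset_Icc_self
        (by rw [closure_Ioo hℓ.ne])
    have hv : ∀ z ∈ Icc 0 p.ℓ, v z = 0 := fun z hz =>
      (uniqueDiffOn_Icc hℓ z hz).eq_deriv _ (h4 z hz)
        ((hasDerivWithinAt_const z (Icc 0 p.ℓ) (0 : ℂ)).congr hu (hu hz))
    have hw : ∀ᵐ z ∂p.μ, w z = 0 := by
      have hmem : ∀ᵐ z ∂p.μ, z ∈ Ioo 0 p.ℓ := ae_restrict_mem measurableSet_Ioo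
      filter_upwards [h5, hmem] with z a hz
      refine a.unique ((hasDerivAt_const z (0 : ℂ)).congr_of_eventuallyEq ?_)
      filter_upwards [Ioo_mem_nhds hz.1 hz.2] with y hy using hv y (Ioo_subset_Icc_self hy)
    have hb : bulk χ = 0 := by
      apply Lp.ext
      have hmem : ∀ᵐ z ∂p.μ, z ∈ Ioo 0 p.ℓ := ae_restrict_mem measurableSet_Ioo
      filter_upwards [h9, hw, hmem, Lp.coeFn_zero ℂ 2 p.μ] with z a b hz c
      rw [a, c, b, hIoo hz]
      simp
    have hd : bdry χ = 0 := by
      rw [h10, hu (right_mem_Icc.mpr hℓ.le), hv _ (right_mem_Icc.mpr hℓ.le)]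
      simp
    change χ = 0
    exact (WithLp.ofLp_injective 2) (Prod.ext hb hd)
  rw [key]
  rfl

/-- `A > 0`. -/
def IsPositive (p : Params) : Prop :=
  ∀ φ : (opA p).domain, φ ≠ 0 → 0 < (inner ℂ (φ : H p) (opA p φ)).re

/-! ### Functions of `A`

`A` is self-adjoint with discrete spectrum, so that `g(A) = ∑ g(λ) P_λ`, where `λ` runs over the
eigenvalues of `A` and `P_λ` is the orthogonal projection onto the eigenspace of `λ`. -/

/-- The eigenspace `{φ ∈ D(A) : A φ = λ φ}` (zero if `λ` is not an eigenvalue). -/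
def eigenspaceA (p : Params) (lam : ℝ) : Submodule ℂ (H p) :=
  (opA p).graph.comap (LinearMap.prod LinearMap.id ((lam : ℂ) • LinearMap.id))

/-- The orthogonal projection `P_λ` onto the eigenspace of `λ` (which is closed). -/
def eigenproj (p : Params) (lam : ℝ) : H p →L[ℂ] H p :=
  (eigenspaceA p lam).topologicalClosure.starProjection

/-- The domain of `g(A)`. -/
def funDomain (p : Params) (g : ℝ → ℝ) : Set (H p) :=
  {φ | Summable fun lam : ℝ => g lam ^ 2 * ‖eigenproj p lam φ‖ ^ 2}

/-- `g(A) φ`, for `φ` in the domain of `g(A)`. -/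
def funA (p : Params) (g : ℝ → ℝ) (φ : H p) : H p :=
  ∑' lam : ℝ, (g lam : ℂ) • eigenproj p lam φ

/-- `D(√A)`. -/
def sqrtDomain (p : Params) : Set (H p) := funDomain p Real.sqrt

/-- The graph norm of `√A`. -/
def graphNorm (p : Params) (φ : H p) : ℝ := ‖φ‖ + ‖funA p Real.sqrt φ‖

/-- The bounded operator `E(t) = -sin(√A t) / √A`. -/
def propagator (p : Params) (t : ℝ) (φ : H p) : H p :=
  funA p (fun lam => -(Real.sin (Real.sqrt lam * t) / Real.sqrt lam)) φ

/-- `φ_f = E f`, that is, `φ_f(t) = ∫ E(t - t') f(t') dt'`. -/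
def solution (p : Params) (f : ℝ → H p) (t : ℝ) : H p :=
  ∫ t' : ℝ, propagator p (t - t') (f t')

/-- `φ` has real-valued components. -/
def IsRealValued {p : Params} (φ : H p) : Prop :=
  (∀ᵐ z ∂p.μ, (bulk φ z).im = 0) ∧ (bdry φ).im = 0

/-- `f ∈ C_{0,R}(ℝ, D(√A))`: `f` is continuous from `ℝ` to `D(√A)` with the graph norm, has compact
support, and takes values with real-valued components. -/
structure IsTestFunction (p : Params) (f : ℝ → H p) : Prop where
  mem_domain : ∀ t, f t ∈ sqrtDomain p
  continuous_graphNorm : ∀ t₀, Filter.Tendsto (fun t => graphNorm p (f t - f t₀))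
    (nhds t₀) (nhds 0)
  compact_support : HasCompactSupport f
  real_valued : ∀ t, IsRealValued (f t)

end DynBC

end

open scoped BoundedContinuousFunction

/-! Put g = √A f, which is continuous with compact support because f is so for the graph norm. The
addition theorem for the sine separates t from t' and gives φ_f(t) = A⁻¹ Φ(t) with Φ(t) = -(sin(√A
t) a - cos(√A t) b), where a = ∫ cos(√A t') g(t') dt' and b = ∫ sin(√A t') g(t') dt' are fixed
vectors of the Hilbert space. Sines and cosines of √A are contractions, strongly continuous in t.
Hence Φ is continuous and bounded by ‖a‖ + ‖b‖, and A^{-1/2} Φ is differentiable in norm with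
derivative Ψ(t) = -(cos(√A t) a + sin(√A t) b), which has the same bound.

It remains to pass from Hilbert space norms to sup norms in z. Two bounded operators into the
bounded continuous functions do this: J (`exists_rep_clm`), giving the continuous representative of
A^{-1/2} φ, and K (`exists_repDeriv_clm`), giving the z-derivative of the representative of A⁻¹ φ.
Then ∂_t of the first component is J Ψ(t) and ∂_z of it is K Φ(t). Continuity in t for the sup norm
yields joint continuity, and the bounds are uniform.

J and K rest on `energy_bound`: integrating by parts, the form of A equals ∫|u'|² + m² ∫|u|² plus
boundary terms, and a trace inequality with small parameter absorbs the latter. So the form and the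
norm control the sup of u (`sup_bound`), and the graph norm of A controls the sup of u'
(`sup_bound_deriv`). Inverse powers of A are bounded by `spectral_gap`: the sup bound limits the
number of eigenvalues ≤ 1, and each is positive. Spectral sums are handled by symmetry of A and
Bessel's inequality alone; completeness of the eigenvectors is never needed. -/

noncomputable section

/-! ### Absolutely continuous functions and the trace inequality -/

namespace AbsolutelyContinuousOnInterval

/-- Composition with a Lipschitz map preserves absolute continuity. -/
theorem lipschitz_comp {X Y : Type*} [PseudoMetricSpace X] [PseudoMetricSpace Y] {f : ℝ → X}
    {g : X → Y} {K : NNReal} {a b : ℝ} (hg : LipschitzWith K g)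
    (hf : AbsolutelyContinuousOnInterval f a b) :
    AbsolutelyContinuousOnInterval (fun z => g (f z)) a b := by
  have h := Filter.Tendsto.const_mul (K : ℝ) hf
  rw [mul_zero] at h
  refine squeeze_zero (fun E => Finset.sum_nonneg fun _ _ => dist_nonneg) (fun E => ?_) h
  rw [Finset.mul_sum]
  exact Finset.sum_le_sum fun i _ => hg.dist_le_mul _ _

theorem integral_eq_sub_of_ae_hasDerivAt {F F' : ℝ → ℝ} {a b : ℝ} (hab : a ≤ b)
    (hF : AbsolutelyContinuousOnInterval F a b)
    (h : ∀ᵐ z ∂volume.restrict (Ioo a b), HasDerivAt F (F' z) z) :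
    IntervalIntegrable F' volume a b ∧ ∫ z in a..b, F' z = F b - F a := by
  have h1 : deriv F =ᵐ[volume.restrict (Ioc a b)] F' := by
    rw [← Measure.restrict_congr_set Ioo_ae_eq_Ioc]
    filter_upwards [h] with z hz using hz.deriv
  have h2 : deriv F =ᵐ[volume.restrict (uIoc a b)] F' := by rwa [uIoc_of_le hab]
  refine ⟨hF.intervalIntegrable_deriv.congr_ae h2, ?_⟩
  rw [← hF.integral_deriv_eq_sub, intervalIntegral.integral_of_le hab,
    intervalIntegral.integral_of_le hab]
  exact (integral_congr_ae h1).symm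

/-- Real and imaginary parts are Lipschitz images of F, hence absolutely continuous, and the real
case applies to each. -/
theorem integral_eq_sub_of_ae_hasDerivAt_complex {F F' : ℝ → ℂ} {a b : ℝ} (hab : a ≤ b)
    (hF : AbsolutelyContinuousOnInterval F a b)
    (h : ∀ᵐ z ∂volume.restrict (Ioo a b), HasDerivAt F (F' z) z) :
    IntervalIntegrable F' volume a b ∧ ∫ z in a..b, F' z = F b - F a := by
  obtain ⟨r1, r2⟩ := integral_eq_sub_of_ae_hasDerivAt (F' := fun z => (F' z).re) hab
    (hF.lipschitz_comp Complex.reCLM.lipschitz)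
    (by filter_upwards [h] with z hz using
      (Complex.reCLM.hasFDerivAt (x := F z)).comp_hasDerivAt z hz)
  obtain ⟨i1, i2⟩ := integral_eq_sub_of_ae_hasDerivAt (F' := fun z => (F' z).im) hab
    (hF.lipschitz_comp Complex.imCLM.lipschitz)
    (by filter_upwards [h] with z hz using
      (Complex.imCLM.hasFDerivAt (x := F z)).comp_hasDerivAt z hz)
  have e : F' = fun z => ((F' z).re : ℂ) + ((F' z).im : ℂ) * Complex.I := by
    funext z
    exact (Complex.re_add_im _).symm
  have r1' : IntervalIntegrable (fun z => ((F' z).re : ℂ)) volume a b :=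
    ⟨r1.1.ofReal, r1.2.ofReal⟩
  have i1' : IntervalIntegrable (fun z => ((F' z).im : ℂ)) volume a b :=
    ⟨i1.1.ofReal, i1.2.ofReal⟩
  refine ⟨by rw [e]; exact r1'.add (i1'.mul_const _), ?_⟩
  rw [e, intervalIntegral.integral_add r1' (i1'.mul_const _), intervalIntegral.integral_mul_const,
    intervalIntegral.integral_ofReal, intervalIntegral.integral_ofReal, r2, i2]
  apply Complex.ext <;> simp

theorem conj_mul {f g : ℝ → ℂ} {a b : ℝ} (hf : AbsolutelyContinuousOnInterval f a b)
    (hg : AbsolutelyContinuousOnInterval g a b) :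
    AbsolutelyContinuousOnInterval (fun z => conj (f z) * g z) a b :=
  (hf.lipschitz_comp Complex.isometry_conj.lipschitz).smul hg

end AbsolutelyContinuousOnInterval

theorem HasDerivAt.conj_mul {f g : ℝ → ℂ} {f' g' : ℂ} {z : ℝ} (hf : HasDerivAt f f' z)
    (hg : HasDerivAt g g' z) :
    HasDerivAt (fun z => conj (f z) * g z) (conj f' * g z + conj (f z) * g') z :=
  ((Complex.conjCLE.toContinuousLinearMap.hasFDerivAt (x := f z)).comp_hasDerivAt z hf).mul hg

/-- The trace inequality for absolutely continuous functions with square integrable derivative. -/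
theorem AbsolutelyContinuousOnInterval.trace_inequality {u v : ℝ → ℂ} {ℓ ε : ℝ} (hℓ : 0 < ℓ)
    (hε : 0 < ε) (hu : AbsolutelyContinuousOnInterval u 0 ℓ)
    (h : ∀ᵐ z ∂volume.restrict (Ioo 0 ℓ), HasDerivAt u (v z) z)
    (hv : MemLp v 2 (volume.restrict (Ioo 0 ℓ))) {x : ℝ} (hx : x ∈ Icc 0 ℓ) :
    ‖u x‖ ^ 2 ≤ ε * (∫ z in Ioo 0 ℓ, ‖v z‖ ^ 2) +
      (ℓ⁻¹ + ε⁻¹) * ∫ z in Ioo 0 ℓ, ‖u z‖ ^ 2 := by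
  have hF := hu.conj_mul hu
  have hcu : ContinuousOn u (Icc 0 ℓ) := by simpa [uIcc_of_le hℓ.le] using hu.continuousOn
  have iu : IntegrableOn (fun z => ‖u z‖ ^ 2) (Ioo 0 ℓ) :=
    ((hcu.norm.pow 2).integrableOn_Icc).mono_set Ioo_subset_Icc_self
  have iv : IntegrableOn (fun z => ‖v z‖ ^ 2) (Ioo 0 ℓ) := hv.integrable_norm_pow (by norm_num)
  set F' : ℝ → ℂ := fun z => conj (v z) * u z + conj (u z) * v z with hF'
  have hd : ∀ᵐ z ∂volume.restrict (Ioo 0 ℓ),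
      HasDerivAt (fun z => conj (u z) * u z) (F' z) z := by
    filter_upwards [h] with z hz using hz.conj_mul hz
  set M := ε * (∫ z in Ioo 0 ℓ, ‖v z‖ ^ 2) + ε⁻¹ * ∫ z in Ioo 0 ℓ, ‖u z‖ ^ 2 with hM
  have iM : IntegrableOn (fun z => ε * ‖v z‖ ^ 2 + ε⁻¹ * ‖u z‖ ^ 2) (Ioo 0 ℓ) :=
    (iv.const_mul _).add (iu.const_mul _)
  have hM' : M = ∫ z in Ioo 0 ℓ, (ε * ‖v z‖ ^ 2 + ε⁻¹ * ‖u z‖ ^ 2) := by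
    rw [integral_add (iv.const_mul _) (iu.const_mul _), integral_const_mul, integral_const_mul]
  have hbd : ∀ z, ‖F' z‖ ≤ ε * ‖v z‖ ^ 2 + ε⁻¹ * ‖u z‖ ^ 2 := by
    intro z
    have h1 : ‖F' z‖ ≤ ‖v z‖ * ‖u z‖ + ‖u z‖ * ‖v z‖ := by
      refine (norm_add_le _ _).trans ?_
      simp
    have h2 : 0 ≤ ε⁻¹ * (ε * ‖v z‖ - ‖u z‖) ^ 2 := by positivity
    have h3 : ε⁻¹ * (ε * ‖v z‖ - ‖u z‖) ^ 2 =
        ε * ‖v z‖ ^ 2 + ε⁻¹ * ‖u z‖ ^ 2 - 2 * (‖v z‖ * ‖u z‖) := by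
      field_simp
      ring
    linarith
  -- By the weighted inequality between means, M is the integral of a majorant of |(‖u‖²)'|, so it
  -- bounds every increment of ‖u‖².
  have hdiff : ∀ a b : ℝ, 0 ≤ a → a ≤ b → b ≤ ℓ → |‖u b‖ ^ 2 - ‖u a‖ ^ 2| ≤ M := by
    intro a b ha hab hb
    have hsub : Ioo a b ⊆ Ioo 0 ℓ := Ioo_subset_Ioo ha hb
    obtain ⟨i1, i2⟩ := AbsolutelyContinuousOnInterval.integral_eq_sub_of_ae_hasDerivAt_complex hab
      (hF.mono (by rw [uIcc_of_le hab, uIcc_of_le hℓ.le]; exact Icc_subset_Icc ha hb))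
      (ae_restrict_of_ae_restrict_of_subset hsub hd)
    have e1 : ((‖u b‖ ^ 2 - ‖u a‖ ^ 2 : ℝ) : ℂ) = ∫ z in a..b, F' z := by
      rw [i2]
      push_cast
      rw [Complex.conj_mul', Complex.conj_mul']
    have e2 : |‖u b‖ ^ 2 - ‖u a‖ ^ 2| = ‖∫ z in a..b, F' z‖ := by
      rw [← e1, Complex.norm_real, Real.norm_eq_abs]
    rw [e2, hM', intervalIntegral.integral_of_le hab, integral_Ioc_eq_integral_Ioo]
    refine (norm_integral_le_of_norm_le (iM.mono_set hsub)
      (Filter.Eventually.of_forall hbd)).trans ?_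
    exact setIntegral_mono_set iM (Filter.Eventually.of_forall fun z => by positivity)
      (Filter.Eventually.of_forall hsub)
  have hpt : ∀ y ∈ Ioo 0 ℓ, ‖u x‖ ^ 2 - M ≤ ‖u y‖ ^ 2 := by
    intro y hy
    rcases le_total x y with hxy | hxy
    · have := (abs_le.mp (hdiff x y hx.1 hxy hy.2.le)).1
      linarith
    · have := (abs_le.mp (hdiff y x hy.1.le hxy hx.2)).2
      linarith
  -- Averaging over y compares the value at x with the mean of ‖u‖²; this is the source of ℓ⁻¹.
  have hint : ℓ * (‖u x‖ ^ 2 - M) ≤ ∫ z in Ioo 0 ℓ, ‖u z‖ ^ 2 := by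
    have h1 : ∫ z in Ioo 0 ℓ, (‖u x‖ ^ 2 - M) = ℓ * (‖u x‖ ^ 2 - M) := by
      simp [hℓ.le]
    rw [← h1]
    exact setIntegral_mono_on (by simp) iu measurableSet_Ioo hpt
  have h5 : ‖u x‖ ^ 2 - M ≤ ℓ⁻¹ * ∫ z in Ioo 0 ℓ, ‖u z‖ ^ 2 := by
    rw [inv_mul_eq_div, le_div_iff₀ hℓ]
    linarith
  rw [add_mul]
  linarith

/-! ### The graph of A: integration by parts and symmetry -/

namespace DynBC

/-- `(φ, χ)` is in the graph of `A`, with `u` representing `φ₁`, `v = u'` and `w = v'`. -/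
structure GraphRep (p : Params) (φ χ : H p) (u v w : ℝ → ℂ) : Prop where
  bulk_eq : bulk φ =ᵐ[p.μ] u
  ac : AbsolutelyContinuousOnInterval u 0 p.ℓ
  ac_deriv : AbsolutelyContinuousOnInterval v 0 p.ℓ
  hasDeriv : ∀ z ∈ Icc 0 p.ℓ, HasDerivWithinAt u (v z) (Icc 0 p.ℓ) z
  hasDeriv_deriv : ∀ᵐ z ∂p.μ, HasDerivAt v (w z) z
  memLp : MemLp w 2 p.μ
  robin : (Real.cos p.α : ℂ) * u 0 + (Real.sin p.α : ℂ) * v 0 = 0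
  bdry_eq : bdry φ = p.β₁' * u p.ℓ - p.β₂' * v p.ℓ
  bulk_op : bulk χ =ᵐ[p.μ] (fun z => -w z + (p.m : ℂ) ^ 2 * u z)
  bdry_op : bdry χ = -(p.β₁ * u p.ℓ - p.β₂ * v p.ℓ)

theorem isGraph_iff {p : Params} {φ χ : H p} :
    IsGraph p φ χ ↔ ∃ u v w, GraphRep p φ χ u v w :=
  ⟨fun ⟨u, v, w, h1, h2, h3, h4, h5, h6, h7, h8, h9, h10⟩ =>
    ⟨u, v, w, h1, h2, h3, h4, h5, h6, h7, h8, h9, h10⟩,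
  fun ⟨u, v, w, h1, h2, h3, h4, h5, h6, h7, h8, h9, h10⟩ =>
    ⟨u, v, w, h1, h2, h3, h4, h5, h6, h7, h8, h9, h10⟩⟩

theorem norm_sq_eq {p : Params} (φ : H p) :
    ‖φ‖ ^ 2 = (∫ z, ‖bulk φ z‖ ^ 2 ∂p.μ) + p.ρ⁻¹ * ‖bdry φ‖ ^ 2 := by
  have h := inner_eq φ φ
  rw [inner_self_eq_norm_sq_to_K, intervalIntegral.integral_of_le p.ℓ_pos.le,
    integral_Ioc_eq_integral_Ioo] at h
  simp_rw [Complex.conj_mul'] at h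
  have h2 : (∫ z in Ioo 0 p.ℓ, ((‖bulk φ z‖ : ℂ) ^ 2)) =
      ((∫ z, ‖bulk φ z‖ ^ 2 ∂p.μ : ℝ) : ℂ) := by
    refine Eq.trans ?_ integral_complex_ofReal
    push_cast
    rfl
  rw [h2] at h
  apply Complex.ofReal_injective
  push_cast at h ⊢
  exact h

theorem integral_bulk_le {p : Params} (φ : H p) : ∫ z, ‖bulk φ z‖ ^ 2 ∂p.μ ≤ ‖φ‖ ^ 2 := by
  rw [norm_sq_eq]
  have : 0 < p.ρ := p.ρ_pos
  have : 0 ≤ p.ρ⁻¹ * ‖bdry φ‖ ^ 2 := by positivity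
  linarith

theorem bdry_sq_le {p : Params} (φ : H p) : ‖bdry φ‖ ^ 2 ≤ p.ρ * ‖φ‖ ^ 2 := by
  have hρ : 0 < p.ρ := p.ρ_pos
  rw [norm_sq_eq, mul_add, mul_inv_cancel_left₀ hρ.ne']
  have : 0 ≤ p.ρ * ∫ z, ‖bulk φ z‖ ^ 2 ∂p.μ :=
    mul_nonneg hρ.le (integral_nonneg fun _ => by positivity)
  linarith

namespace GraphRep

variable {p : Params} {φ χ φ' χ' : H p} {u v w u' v' w' : ℝ → ℂ}

theorem continuousOn (h : GraphRep p φ χ u v w) : ContinuousOn u (Icc 0 p.ℓ) := by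
  simpa [uIcc_of_le p.ℓ_pos.le] using h.ac.continuousOn

theorem continuousOn_deriv (h : GraphRep p φ χ u v w) : ContinuousOn v (Icc 0 p.ℓ) := by
  simpa [uIcc_of_le p.ℓ_pos.le] using h.ac_deriv.continuousOn

theorem ae_hasDerivAt (h : GraphRep p φ χ u v w) : ∀ᵐ z ∂p.μ, HasDerivAt u (v z) z := by
  have hmem : ∀ᵐ z ∂p.μ, z ∈ Ioo 0 p.ℓ := ae_restrict_mem measurableSet_Ioo
  filter_upwards [hmem] with z hz
  exact (h.hasDeriv z (Ioo_subset_Icc_self hz)).hasDerivAt (Icc_mem_nhds hz.1 hz.2)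

theorem memLp_deriv (h : GraphRep p φ χ u v w) : MemLp v 2 p.μ := by
  obtain ⟨C, hC⟩ := isCompact_Icc.exists_bound_of_continuousOn h.continuousOn_deriv
  have : IsFiniteMeasure p.μ := by unfold Params.μ; infer_instance
  refine MemLp.of_bound ((h.continuousOn_deriv.mono Ioo_subset_Icc_self).aestronglyMeasurable
    measurableSet_Ioo) C ?_
  have hmem : ∀ᵐ z ∂p.μ, z ∈ Ioo 0 p.ℓ := ae_restrict_mem measurableSet_Ioo
  filter_upwards [hmem] with z hz using hC z (Ioo_subset_Icc_self hz)

theorem integral_norm_sq (h : GraphRep p φ χ u v w) :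
    ∫ z, ‖bulk φ z‖ ^ 2 ∂p.μ = ∫ z in Ioo 0 p.ℓ, ‖u z‖ ^ 2 :=
  integral_congr_ae (by filter_upwards [h.bulk_eq] with z hz; rw [hz])

/-- The form `(φ, A χ)` after an integration by parts. -/
theorem inner_eq_form (h : GraphRep p φ χ u v w) (h' : GraphRep p φ' χ' u' v' w') :
    inner ℂ φ χ' = (∫ z in Ioo 0 p.ℓ, conj (v z) * v' z) +
      (p.m : ℂ) ^ 2 * (∫ z in Ioo 0 p.ℓ, conj (u z) * u' z) +
      conj (u 0) * v' 0 - conj (u p.ℓ) * v' p.ℓ -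
      (p.ρ : ℂ)⁻¹ * (conj (p.β₁' * u p.ℓ - p.β₂' * v p.ℓ) * (p.β₁ * u' p.ℓ - p.β₂ * v' p.ℓ)) := by
  have hℓ := p.ℓ_pos.le
  obtain ⟨i1, i2⟩ :=
    AbsolutelyContinuousOnInterval.integral_eq_sub_of_ae_hasDerivAt_complex hℓ
      (h.ac.conj_mul h'.ac_deriv)
      (F' := fun z => conj (v z) * v' z + conj (u z) * w' z)
      (by filter_upwards [h.ae_hasDerivAt, h'.hasDeriv_deriv] with z a b using a.conj_mul b)
  have ci : ∀ {f g : ℝ → ℂ}, ContinuousOn f (Icc 0 p.ℓ) → ContinuousOn g (Icc 0 p.ℓ) →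
      IntegrableOn (fun z => conj (f z) * g z) (Ioo 0 p.ℓ) := fun hf hg =>
    (((Complex.continuous_conj.comp_continuousOn hf).mul hg).integrableOn_Icc).mono_set
      Ioo_subset_Icc_self
  have iv := ci h.continuousOn_deriv h'.continuousOn_deriv
  have iu := ci h.continuousOn h'.continuousOn
  rw [intervalIntegral.integral_of_le hℓ, integral_Ioc_eq_integral_Ioo] at i2
  rw [intervalIntegrable_iff_integrableOn_Ioo_of_le hℓ] at i1
  -- The full derivative of conj u · v' is integrable by absolute continuity; removing its
  -- continuous part leaves this term.
  have iw : IntegrableOn (fun z => conj (u z) * w' z) (Ioo 0 p.ℓ) := by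
    refine (i1.sub iv).congr (Filter.Eventually.of_forall fun z => ?_)
    simp
  rw [integral_add iv iw] at i2
  rw [inner_eq, intervalIntegral.integral_of_le hℓ, integral_Ioc_eq_integral_Ioo, h.bdry_eq,
    h'.bdry_op]
  have e : ∫ z in Ioo 0 p.ℓ, conj (bulk φ z) * bulk χ' z =
      ∫ z in Ioo 0 p.ℓ, (-(conj (u z) * w' z) + (p.m : ℂ) ^ 2 * (conj (u z) * u' z)) := by
    refine integral_congr_ae ?_
    filter_upwards [h.bulk_eq, h'.bulk_op] with z a b
    rw [a, b]
    ring
  have e2 := integral_add iw.neg (iu.const_mul ((p.m : ℂ) ^ 2))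
  simp only [Pi.neg_apply, integral_neg, integral_const_mul] at e2
  rw [e, e2]
  linear_combination -i2

/-- `A` is symmetric. -/
theorem inner_symm (h : GraphRep p φ χ u v w) (h' : GraphRep p φ' χ' u' v' w') :
    inner ℂ φ χ' = inner ℂ χ φ' := by
  have hρ : (p.ρ : ℂ) ≠ 0 := by exact_mod_cast (show p.ρ ≠ 0 from ne_of_gt p.ρ_pos)
  rw [← inner_conj_symm χ φ', inner_eq_form h h', inner_eq_form h' h]
  have hc : ∀ f g : ℝ → ℂ, conj (∫ z in Ioo 0 p.ℓ, conj (f z) * g z) =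
      ∫ z in Ioo 0 p.ℓ, conj (g z) * f z := by
    intro f g
    rw [← integral_conj]
    refine integral_congr_ae (Filter.Eventually.of_forall fun z => ?_)
    simp [mul_comm]
  simp only [map_sub, map_add, map_mul, hc, map_pow, Complex.conj_ofReal, Complex.conj_conj,
    map_inv₀]
  have r1 : conj ((Real.cos p.α : ℂ) * u 0 + (Real.sin p.α : ℂ) * v 0) = 0 := by
    rw [h.robin, map_zero]
  simp only [map_add, map_mul, Complex.conj_ofReal] at r1
  have r2 := h'.robin
  have hcs : (Real.cos p.α : ℂ) ^ 2 + (Real.sin p.α : ℂ) ^ 2 = 1 := by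
    exact_mod_cast Real.cos_sq_add_sin_sq p.α
  -- Both pairs of Cauchy data at 0 are annihilated by the same real functional (cos α, sin α), so
  -- their Wronskian vanishes.
  have h0 : conj (u 0) * v' 0 = conj (v 0) * u' 0 := by
    linear_combination (-(conj (u 0) * v' 0) + conj (v 0) * u' 0) * hcs +
      (Real.cos p.α * v' 0 - Real.sin p.α * u' 0) * r1 +
      (Real.sin p.α * conj (u 0) - Real.cos p.α * conj (v 0)) * r2
  -- The weight ρ⁻¹ is exactly what makes the boundary component cancel the Wronskian at ℓ.
  have hdet : (p.ρ : ℂ)⁻¹ * (p.β₁' * p.β₂ - p.β₁ * p.β₂') = 1 := by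
    rw [← inv_mul_cancel₀ hρ, Params.ρ]
    push_cast
    ring
  linear_combination h0 + (conj (u p.ℓ) * v' p.ℓ - conj (v p.ℓ) * u' p.ℓ) * hdet

end GraphRep

/-! ### Energy and sup-norm estimates on D(A) -/

/-- The boundary form at `z = ℓ` is bounded in terms of the trace and the boundary component. -/
theorem boundary_form_le (p : Params) : ∃ C : ℝ, 0 ≤ C ∧ ∀ a b : ℂ,
    (conj a * b + (p.ρ : ℂ)⁻¹ * (conj (p.β₁' * a - p.β₂' * b) * (p.β₁ * a - p.β₂ * b))).re ≤
      C * (‖a‖ ^ 2 + ‖p.β₁' * a - p.β₂' * b‖ ^ 2) := by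
  have hρ : 0 < p.ρ := p.ρ_pos
  -- The derivative trace b is eliminated through β₂' b = β₁' a - y. If β₂' = 0 then b cannot be
  -- recovered from a and y, but it drops out of the real part; γ is then 0 by convention, and the
  -- identity `e1` holds in both cases.
  set γ := p.β₂ / p.β₂' with hγ
  refine ⟨p.ρ⁻¹ * (|p.β₁ * p.β₁'| + |p.β₁| + 2 * |γ| * (p.β₁' ^ 2 + 1)), by positivity, ?_⟩
  intro a b
  set y : ℂ := p.β₁' * a - p.β₂' * b with hy
  have e1 : p.ρ * (conj a * b + (p.ρ : ℂ)⁻¹ * (conj y * (p.β₁ * a - p.β₂ * b))).re =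
      -(p.β₁ * p.β₁') * ‖a‖ ^ 2 + 2 * p.β₁ * (conj a * y).re + γ * ‖p.β₁' * a - y‖ ^ 2 := by
    have h2 : γ * ‖p.β₁' * a - y‖ ^ 2 = p.β₂ * p.β₂' * ‖b‖ ^ 2 := by
      have : p.β₁' * a - y = p.β₂' * b := by rw [hy]; ring
      rw [this, norm_mul, mul_pow, Complex.norm_real, Real.norm_eq_abs, sq_abs, hγ]
      by_cases h0 : p.β₂' = 0
      · simp [h0]
      · field_simp
    rw [h2, ← Complex.normSq_eq_norm_sq, ← Complex.normSq_eq_norm_sq, ← Complex.ofReal_inv,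
      Complex.add_re, Complex.re_ofReal_mul, mul_add, mul_inv_cancel_left₀ hρ.ne', hy]
    simp only [Complex.normSq_apply, Params.ρ, Complex.mul_re, Complex.mul_im, Complex.sub_re,
      Complex.sub_im, Complex.conj_re, Complex.conj_im, Complex.ofReal_re, Complex.ofReal_im]
    ring
  have b1 : -(p.β₁ * p.β₁') * ‖a‖ ^ 2 ≤ |p.β₁ * p.β₁'| * ‖a‖ ^ 2 :=
    mul_le_mul_of_nonneg_right (neg_le_abs _) (by positivity)
  have b2 : 2 * p.β₁ * (conj a * y).re ≤ |p.β₁| * (‖a‖ ^ 2 + ‖y‖ ^ 2) := by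
    have h1 : |(conj a * y).re| ≤ ‖a‖ * ‖y‖ := by
      simpa using Complex.abs_re_le_norm (conj a * y)
    have h2 : p.β₁ * (conj a * y).re ≤ |p.β₁| * (‖a‖ * ‖y‖) := by
      refine (le_abs_self _).trans ?_
      rw [abs_mul]
      exact mul_le_mul_of_nonneg_left h1 (abs_nonneg _)
    nlinarith [mul_nonneg (abs_nonneg p.β₁) (sq_nonneg (‖a‖ - ‖y‖))]
  have b3 : γ * ‖p.β₁' * a - y‖ ^ 2 ≤ |γ| * (2 * (p.β₁' ^ 2 * ‖a‖ ^ 2 + ‖y‖ ^ 2)) := by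
    refine mul_le_mul (le_abs_self _) ?_ (by positivity) (abs_nonneg _)
    have h1 : ‖p.β₁' * a - y‖ ≤ |p.β₁'| * ‖a‖ + ‖y‖ := by
      refine (norm_sub_le _ _).trans ?_
      simp
    have h2 := pow_le_pow_left₀ (norm_nonneg _) h1 2
    nlinarith [sq_nonneg (|p.β₁'| * ‖a‖ - ‖y‖), sq_abs p.β₁']
  rw [mul_assoc, le_inv_mul_iff₀ hρ, e1]
  have n1 : 0 ≤ |p.β₁ * p.β₁'| * ‖y‖ ^ 2 := by positivity
  have n2 : 0 ≤ |γ| * ‖a‖ ^ 2 := by positivity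
  have n3 : 0 ≤ |γ| * (p.β₁' ^ 2 * ‖y‖ ^ 2) := by positivity
  nlinarith

/-- The energy bound: the form of `A` controls the `H¹` norm. -/
theorem energy_bound (p : Params) (hα : p.α ≠ 0) : ∃ C : ℝ, 0 ≤ C ∧ ∀ (φ χ : H p) (u v w : ℝ → ℂ),
    GraphRep p φ χ u v w →
      ∫ z in Ioo 0 p.ℓ, ‖v z‖ ^ 2 ≤ 2 * (inner ℂ φ χ).re + C * ‖φ‖ ^ 2 := by
  obtain ⟨B, hB, hb⟩ := boundary_form_le p
  have hρ : 0 < p.ρ := p.ρ_pos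
  have hsin : Real.sin p.α ≠ 0 :=
    (Real.sin_pos_of_pos_of_lt_pi (lt_of_le_of_ne p.α_mem.1 (Ne.symm hα)) p.α_mem.2).ne'
  set κ := |Real.cos p.α / Real.sin p.α| with hκ
  have hκ0 : 0 ≤ κ := abs_nonneg _
  -- κ and B weigh the traces at 0 and at ℓ, and the 1 keeps D positive. Since D ε = 1/2, the traces
  -- cost only half of ∫|v|², whence the factor 2 in front of the form.
  set D := κ + B + 1 with hD
  have hD0 : 0 < D := by positivity
  set ε := (2 * D)⁻¹ with hε
  have hε0 : 0 < ε := by positivity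
  have hℓ := p.ℓ_pos
  refine ⟨2 * (D * (p.ℓ⁻¹ + ε⁻¹) + B * p.ρ), by positivity, ?_⟩
  intro φ χ u v w h
  set V := ∫ z in Ioo 0 p.ℓ, ‖v z‖ ^ 2 with hV
  set U := ∫ z in Ioo 0 p.ℓ, ‖u z‖ ^ 2 with hU
  have hU0 : 0 ≤ U := integral_nonneg fun _ => by positivity
  have tr : ∀ x ∈ Icc 0 p.ℓ, ‖u x‖ ^ 2 ≤ ε * V + (p.ℓ⁻¹ + ε⁻¹) * U := fun x hx =>
    h.ac.trace_inequality hℓ hε0 h.ae_hasDerivAt h.memLp_deriv hx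
  have t0 := tr 0 (left_mem_Icc.mpr hℓ.le)
  have t1 := tr p.ℓ (right_mem_Icc.mpr hℓ.le)
  have hUφ : U ≤ ‖φ‖ ^ 2 := by
    rw [hU, ← h.integral_norm_sq]
    exact integral_bulk_le φ
  have hy := bdry_sq_le φ
  have hform := congrArg Complex.re (h.inner_eq_form h)
  have hint : ∀ f : ℝ → ℂ, (∫ z in Ioo 0 p.ℓ, conj (f z) * f z) =
      ((∫ z in Ioo 0 p.ℓ, ‖f z‖ ^ 2 : ℝ) : ℂ) := by
    intro f
    refine Eq.trans ?_ integral_complex_ofReal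
    refine integral_congr_ae (Filter.Eventually.of_forall fun z => ?_)
    simp [Complex.conj_mul']
  -- As sin α ≠ 0, the Robin condition expresses the derivative at 0 through the value there.
  have hv0 : v 0 = -((Real.cos p.α / Real.sin p.α : ℝ) : ℂ) * u 0 := by
    have hs : (Real.sin p.α : ℂ) ≠ 0 := by exact_mod_cast hsin
    rw [Complex.ofReal_div]
    field_simp
    linear_combination h.robin
  have e0 : (conj (u 0) * v 0).re = -(Real.cos p.α / Real.sin p.α) * ‖u 0‖ ^ 2 := by
    rw [hv0]
    have : conj (u 0) * (-((Real.cos p.α / Real.sin p.α : ℝ) : ℂ) * u 0) =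
        ((-(Real.cos p.α / Real.sin p.α) * ‖u 0‖ ^ 2 : ℝ) : ℂ) := by
      rw [mul_left_comm, Complex.conj_mul']
      push_cast
      ring
    rw [this, Complex.ofReal_re]
  have e0' : -(κ * ‖u 0‖ ^ 2) ≤ (conj (u 0) * v 0).re := by
    rw [e0, neg_mul]
    exact neg_le_neg (mul_le_mul_of_nonneg_right (le_abs_self _) (by positivity))
  have e1 := hb (u p.ℓ) (v p.ℓ)
  rw [← h.bdry_eq] at e1
  have hm : 0 ≤ p.m ^ 2 * U := by positivity
  have hq : (inner ℂ φ χ).re = V + p.m ^ 2 * U + (conj (u 0) * v 0).re -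
      (conj (u p.ℓ) * v p.ℓ +
        (p.ρ : ℂ)⁻¹ * (conj (bdry φ) * (p.β₁ * u p.ℓ - p.β₂ * v p.ℓ))).re := by
    rw [hform, hint, hint, ← h.bdry_eq, ← Complex.ofReal_pow, ← Complex.ofReal_mul]
    simp only [Complex.add_re, Complex.sub_re, Complex.ofReal_re]
    ring
  set t := ε * V + (p.ℓ⁻¹ + ε⁻¹) * U with ht
  have ht0 : 0 ≤ t := le_trans (by positivity) t0
  have k1 : κ * ‖u 0‖ ^ 2 ≤ κ * t := mul_le_mul_of_nonneg_left t0 hκ0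
  have k2 : B * ‖u p.ℓ‖ ^ 2 ≤ B * t := mul_le_mul_of_nonneg_left t1 hB
  have k3 : B * ‖bdry φ‖ ^ 2 ≤ B * (p.ρ * ‖φ‖ ^ 2) := mul_le_mul_of_nonneg_left hy hB
  have k4 : D * t = V / 2 + D * (p.ℓ⁻¹ + ε⁻¹) * U := by
    have : D * ε = 1 / 2 := by rw [hε]; field_simp
    rw [ht, mul_add, ← mul_assoc, this]
    ring
  have k5 : D * (p.ℓ⁻¹ + ε⁻¹) * U ≤ D * (p.ℓ⁻¹ + ε⁻¹) * ‖φ‖ ^ 2 :=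
    mul_le_mul_of_nonneg_left hUφ (by positivity)
  have k6 : (κ + B) * t ≤ D * t := mul_le_mul_of_nonneg_right (by linarith) ht0
  linarith

/-- Elements of `D(A)` are bounded by the form of `A`. -/
theorem sup_bound (p : Params) (hα : p.α ≠ 0) : ∃ C : ℝ, 0 ≤ C ∧ ∀ (φ χ : H p) (u v w : ℝ → ℂ),
    GraphRep p φ χ u v w → ∀ z ∈ Icc 0 p.ℓ,
      ‖u z‖ ^ 2 ≤ 2 * (inner ℂ φ χ).re + C * ‖φ‖ ^ 2 := by
  obtain ⟨C, hC, hc⟩ := energy_bound p hα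
  have hℓ := p.ℓ_pos
  refine ⟨C + (p.ℓ⁻¹ + 1⁻¹), by positivity, fun φ χ u v w h z hz => ?_⟩
  have t := h.ac.trace_inequality hℓ one_pos h.ae_hasDerivAt h.memLp_deriv hz
  have e := hc φ χ u v w h
  have hU : ∫ z in Ioo 0 p.ℓ, ‖u z‖ ^ 2 ≤ ‖φ‖ ^ 2 := by
    rw [← h.integral_norm_sq]
    exact integral_bulk_le φ
  have := mul_le_mul_of_nonneg_left hU (show 0 ≤ p.ℓ⁻¹ + 1⁻¹ by positivity)
  rw [add_mul]
  linarith

/-- The derivatives of elements of `D(A)` are bounded by the graph norm of `A`. -/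
theorem sup_bound_deriv (p : Params) (hα : p.α ≠ 0) : ∃ C : ℝ, 0 ≤ C ∧
    ∀ (φ χ : H p) (u v w : ℝ → ℂ), GraphRep p φ χ u v w → ∀ z ∈ Icc 0 p.ℓ,
      ‖v z‖ ^ 2 ≤ C * (‖φ‖ ^ 2 + ‖χ‖ ^ 2) := by
  obtain ⟨C, hC, hc⟩ := energy_bound p hα
  have hℓ := p.ℓ_pos
  -- The trace inequality is applied to v with ε = 1. The first two terms come from ∫|w|², where w =
  -- m² u - χ₁, and the last from the energy bound for ∫|v|².
  refine ⟨2 + 2 * p.m ^ 4 + (p.ℓ⁻¹ + 1⁻¹) * (1 + C), by positivity,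
    fun φ χ u v w h z hz => ?_⟩
  have t := h.ac_deriv.trace_inequality hℓ one_pos h.hasDeriv_deriv h.memLp hz
  have e := hc φ χ u v w h
  have hU : ∫ z in Ioo 0 p.ℓ, ‖u z‖ ^ 2 ≤ ‖φ‖ ^ 2 := by
    rw [← h.integral_norm_sq]
    exact integral_bulk_le φ
  have hq : 2 * (inner ℂ φ χ).re ≤ ‖φ‖ ^ 2 + ‖χ‖ ^ 2 := by
    have h1 := (Complex.re_le_norm (inner ℂ φ χ)).trans (norm_inner_le_norm φ χ)
    nlinarith [sq_nonneg (‖φ‖ - ‖χ‖)]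
  have hW : ∫ z in Ioo 0 p.ℓ, ‖w z‖ ^ 2 ≤ 2 * p.m ^ 4 * ‖φ‖ ^ 2 + 2 * ‖χ‖ ^ 2 := by
    have iu : Integrable (fun z => ‖u z‖ ^ 2) p.μ :=
      ((h.continuousOn.norm.pow 2).integrableOn_Icc).mono_set Ioo_subset_Icc_self
    have iχ : Integrable (fun z => ‖bulk χ z‖ ^ 2) p.μ :=
      (Lp.memLp (bulk χ)).integrable_norm_pow (by norm_num)
    have iw : Integrable (fun z => ‖w z‖ ^ 2) p.μ := h.memLp.integrable_norm_pow (by norm_num)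
    have hle : ∫ z, ‖w z‖ ^ 2 ∂p.μ ≤
        ∫ z, (2 * p.m ^ 4 * ‖u z‖ ^ 2 + 2 * ‖bulk χ z‖ ^ 2) ∂p.μ := by
      refine integral_mono_ae iw ((iu.const_mul _).add (iχ.const_mul _)) ?_
      filter_upwards [h.bulk_op] with z hz
      have h1 : w z = (p.m : ℂ) ^ 2 * u z - bulk χ z := by rw [hz]; ring
      have h2 : ‖w z‖ ≤ p.m ^ 2 * ‖u z‖ + ‖bulk χ z‖ := by
        rw [h1]
        refine (norm_sub_le _ _).trans ?_
        simp
      have h3 := pow_le_pow_left₀ (norm_nonneg _) h2 2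
      change ‖w z‖ ^ 2 ≤ 2 * p.m ^ 4 * ‖u z‖ ^ 2 + 2 * ‖bulk χ z‖ ^ 2
      nlinarith [sq_nonneg (p.m ^ 2 * ‖u z‖ - ‖bulk χ z‖)]
    rw [integral_add (iu.const_mul _) (iχ.const_mul _), integral_const_mul,
      integral_const_mul] at hle
    have k1 := mul_le_mul_of_nonneg_left hU (show 0 ≤ 2 * p.m ^ 4 by positivity)
    have k2 := integral_bulk_le χ
    change ∫ z, ‖w z‖ ^ 2 ∂p.μ ≤ _
    change 2 * p.m ^ 4 * ∫ z, ‖u z‖ ^ 2 ∂p.μ ≤ _ at k1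
    linarith
  have hV : ∫ z in Ioo 0 p.ℓ, ‖v z‖ ^ 2 ≤ (1 + C) * (‖φ‖ ^ 2 + ‖χ‖ ^ 2) := by
    have := mul_nonneg hC (sq_nonneg ‖χ‖)
    linarith
  have k := mul_le_mul_of_nonneg_left hV (show 0 ≤ p.ℓ⁻¹ + 1⁻¹ by positivity)
  have k' : 0 ≤ p.m ^ 4 * ‖χ‖ ^ 2 := by positivity
  linarith [sq_nonneg ‖φ‖]

/-! ### Continuous representatives as linear maps on the graph -/

/-- Continuous functions that agree almost everywhere on (0, ℓ) agree on [0, ℓ], and so do their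
derivatives. This makes `rep` and `repDeriv` linear although representatives are chosen arbitrarily.
-/
theorem GraphRep.linear_combination {p : Params} {φ χ φ' χ' χ'' : H p}
    {u v w u' v' w' u'' v'' w'' : ℝ → ℂ} (a b : ℂ) (h : GraphRep p φ χ u v w)
    (h' : GraphRep p φ' χ' u' v' w') (h'' : GraphRep p (a • φ + b • φ') χ'' u'' v'' w'')
    {z : ℝ} (hz : z ∈ Icc 0 p.ℓ) :
    u'' z = a * u z + b * u' z ∧ v'' z = a * v z + b * v' z := by
  have hℓ := p.ℓ_pos
  have hae : u'' =ᵐ[p.μ] fun z => a * u z + b * u' z := by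
    filter_upwards [Lp.coeFn_add (a • bulk φ) (b • bulk φ'), Lp.coeFn_smul a (bulk φ),
      Lp.coeFn_smul b (bulk φ'), h.bulk_eq, h'.bulk_eq, h''.bulk_eq] with z k1 k2 k3 k4 k5 k6
    rw [← k6]
    change (a • bulk φ + b • bulk φ') z = _
    rw [k1, Pi.add_apply, k2, k3, Pi.smul_apply, Pi.smul_apply, k4, k5]
    rfl
  have hcont : ContinuousOn (fun z => a * u z + b * u' z) (Icc 0 p.ℓ) :=
    (continuousOn_const.mul h.continuousOn).add (continuousOn_const.mul h'.continuousOn)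
  have hIoo : EqOn u'' (fun z => a * u z + b * u' z) (Ioo 0 p.ℓ) :=
    Measure.eqOn_open_of_ae_eq hae isOpen_Ioo (h''.continuousOn.mono Ioo_subset_Icc_self)
      (hcont.mono Ioo_subset_Icc_self)
  have hu : EqOn u'' (fun z => a * u z + b * u' z) (Icc 0 p.ℓ) :=
    hIoo.of_subset_closure h''.continuousOn hcont Ioo_subset_Icc_self (by rw [closure_Ioo hℓ.ne])
  refine ⟨hu hz, (uniqueDiffOn_Icc hℓ z hz).eq_deriv _ (h''.hasDeriv z hz) ?_⟩
  exact (((h.hasDeriv z hz).const_mul a).add ((h'.hasDeriv z hz).const_mul b)).congr hu (hu hz)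

/-- The bounded continuous extension to `ℝ` of a continuous function on `[0, ℓ]`. -/
def extend (p : Params) (u : ℝ → ℂ) (hu : ContinuousOn u (Icc 0 p.ℓ)) : ℝ →ᵇ ℂ :=
  (BoundedContinuousFunction.mkOfCompact ⟨_, hu.domRestrict⟩).compContinuous
    ⟨projIcc 0 p.ℓ p.ℓ_pos.le, continuous_projIcc⟩

theorem extend_apply (p : Params) (u : ℝ → ℂ) (hu : ContinuousOn u (Icc 0 p.ℓ)) (z : ℝ) :
    extend p u hu z = u (projIcc 0 p.ℓ p.ℓ_pos.le z) := rfl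

theorem exists_graphRep {p : Params} (x : graphA p) :
    ∃ f : (ℝ → ℂ) × (ℝ → ℂ) × (ℝ → ℂ), GraphRep p x.1.1 x.1.2 f.1 f.2.1 f.2.2 := by
  obtain ⟨u, v, w, h⟩ := isGraph_iff.mp x.2
  exact ⟨(u, v, w), h⟩

theorem graphRep_choose_add {p : Params} (a b : ℂ) (x y : graphA p) {z : ℝ} (hz : z ∈ Icc 0 p.ℓ) :
    (exists_graphRep (a • x + b • y)).choose.1 z =
        a * (exists_graphRep x).choose.1 z + b * (exists_graphRep y).choose.1 z ∧
      (exists_graphRep (a • x + b • y)).choose.2.1 z =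
        a * (exists_graphRep x).choose.2.1 z + b * (exists_graphRep y).choose.2.1 z :=
  GraphRep.linear_combination a b (exists_graphRep x).choose_spec (exists_graphRep y).choose_spec
    (exists_graphRep (a • x + b • y)).choose_spec hz

/-- The continuous representative of `φ₁`, for `φ ∈ D(A)`, extended to `ℝ`. -/
def rep (p : Params) : graphA p →ₗ[ℂ] (ℝ →ᵇ ℂ) where
  toFun x := extend p (exists_graphRep x).choose.1 (exists_graphRep x).choose_spec.continuousOn
  map_add' x y := by
    ext z
    have h := (graphRep_choose_add 1 1 x y (projIcc 0 p.ℓ p.ℓ_pos.le z).2).1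
    simp only [one_smul, one_mul] at h
    exact h
  map_smul' c x := by
    ext z
    have h := (graphRep_choose_add c 0 x x (projIcc 0 p.ℓ p.ℓ_pos.le z).2).1
    simp only [zero_smul, add_zero, zero_mul] at h
    exact h

/-- The derivative of the continuous representative of `φ₁`, for `φ ∈ D(A)`, extended to `ℝ`. -/
def repDeriv (p : Params) : graphA p →ₗ[ℂ] (ℝ →ᵇ ℂ) where
  toFun x :=
    extend p (exists_graphRep x).choose.2.1 (exists_graphRep x).choose_spec.continuousOn_deriv
  map_add' x y := by
    ext z
    have h := (graphRep_choose_add 1 1 x y (projIcc 0 p.ℓ p.ℓ_pos.le z).2).2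
    simp only [one_smul, one_mul] at h
    exact h
  map_smul' c x := by
    ext z
    have h := (graphRep_choose_add c 0 x x (projIcc 0 p.ℓ p.ℓ_pos.le z).2).2
    simp only [zero_smul, add_zero, zero_mul] at h
    exact h

theorem exists_graphRep_rep {p : Params} (x : graphA p) : ∃ u v w, GraphRep p x.1.1 x.1.2 u v w ∧
    (∀ z, rep p x z = u (projIcc 0 p.ℓ p.ℓ_pos.le z)) ∧
    (∀ z, repDeriv p x z = v (projIcc 0 p.ℓ p.ℓ_pos.le z)) ∧
    (∀ z ∈ Icc 0 p.ℓ, rep p x z = u z) ∧ (∀ z ∈ Icc 0 p.ℓ, repDeriv p x z = v z) := by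
  refine ⟨_, _, _, (exists_graphRep x).choose_spec, fun z => rfl, fun z => rfl,
    fun z hz => ?_, fun z hz => ?_⟩
  · change extend p _ (exists_graphRep x).choose_spec.continuousOn z = _
    rw [extend_apply, projIcc_of_mem _ hz]
  · change extend p _ (exists_graphRep x).choose_spec.continuousOn_deriv z = _
    rw [extend_apply, projIcc_of_mem _ hz]

theorem norm_rep_sq_le (p : Params) (hα : p.α ≠ 0) : ∃ C : ℝ, 0 ≤ C ∧ ∀ x : graphA p, ∀ z,
    ‖rep p x z‖ ^ 2 ≤ 2 * (inner ℂ x.1.1 x.1.2).re + C * ‖x.1.1‖ ^ 2 := by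
  obtain ⟨C, hC, h⟩ := sup_bound p hα
  refine ⟨C, hC, fun x z => ?_⟩
  obtain ⟨u, v, w, hr, hu, -⟩ := exists_graphRep_rep x
  rw [hu]
  exact h _ _ _ _ _ hr _ (projIcc 0 p.ℓ p.ℓ_pos.le z).2

theorem norm_repDeriv_sq_le (p : Params) (hα : p.α ≠ 0) : ∃ C : ℝ, 0 ≤ C ∧ ∀ x : graphA p, ∀ z,
    ‖repDeriv p x z‖ ^ 2 ≤ C * (‖x.1.1‖ ^ 2 + ‖x.1.2‖ ^ 2) := by
  obtain ⟨C, hC, h⟩ := sup_bound_deriv p hα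
  refine ⟨C, hC, fun x z => ?_⟩
  obtain ⟨u, v, w, hr, hu, hv, -⟩ := exists_graphRep_rep x
  rw [hv]
  exact h _ _ _ _ _ hr _ (projIcc 0 p.ℓ p.ℓ_pos.le z).2

theorem ae_mem_Ioo (p : Params) : ∀ᵐ z ∂p.μ, z ∈ Ioo 0 p.ℓ := ae_restrict_mem measurableSet_Ioo

instance (p : Params) : IsFiniteMeasure p.μ := by unfold Params.μ; infer_instance

theorem toLp_rep {p : Params} (x : graphA p) :
    BoundedContinuousFunction.toLp 2 p.μ ℂ (rep p x) = bulk x.1.1 := by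
  apply Lp.ext
  obtain ⟨u, v, w, hr, -, -, hu, -⟩ := exists_graphRep_rep x
  filter_upwards [BoundedContinuousFunction.coeFn_toLp p.μ ℂ (rep p x) (p := 2), hr.bulk_eq,
    ae_mem_Ioo p] with z a b hz
  rw [a, b, hu z (Ioo_subset_Icc_self hz)]

/-- The integrated form of u' = v survives uniform limits, so it can be summed over the spectrum. -/
theorem rep_eq_integral {p : Params} (x : graphA p) {z : ℝ} (hz : z ∈ Icc 0 p.ℓ) :
    rep p x z = rep p x 0 + ∫ y in (0 : ℝ)..z, repDeriv p x y := by
  obtain ⟨u, v, w, hr, -, -, hu, hv⟩ := exists_graphRep_rep x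
  have h0 : (0 : ℝ) ∈ Icc 0 p.ℓ := left_mem_Icc.mpr p.ℓ_pos.le
  have hsub : Icc 0 z ⊆ Icc 0 p.ℓ := Icc_subset_Icc_right hz.2
  rw [intervalIntegral.integral_eq_sub_of_hasDerivAt_of_le (f := rep p x) hz.1
    (rep p x).continuous.continuousOn (fun y hy => ?_)
    ((repDeriv p x).continuous.intervalIntegrable _ _)]
  · ring
  · have hy' : y ∈ Ioo 0 p.ℓ := ⟨hy.1, hy.2.trans_le hz.2⟩
    rw [hv y (Ioo_subset_Icc_self hy')]
    refine ((hr.hasDeriv y (Ioo_subset_Icc_self hy')).hasDerivAt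
      (Icc_mem_nhds hy'.1 hy'.2)).congr_of_eventuallyEq ?_
    filter_upwards [Icc_mem_nhds hy'.1 hy'.2] with t ht using hu t ht

/-! ### Eigenspaces and spectral projections -/

theorem mem_eigenspaceA {p : Params} {lam : ℝ} {φ : H p} :
    φ ∈ eigenspaceA p lam ↔ IsGraph p φ ((lam : ℂ) • φ) :=
  mem_graph_opA _ _

theorem prod_smul_mem_graphA {p : Params} {lam : ℝ} {φ : H p} (h : φ ∈ eigenspaceA p lam) :
    (φ, (lam : ℂ) • φ) ∈ graphA p :=
  show IsGraph p φ ((lam : ℂ) • φ) from mem_eigenspaceA.mp h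

/-- An eigenvector `φ`, as the element `(φ, λ φ)` of the graph. -/
def toGraph (p : Params) (lam : ℝ) : eigenspaceA p lam →ₗ[ℂ] graphA p where
  toFun φ := ⟨((φ : H p), (lam : ℂ) • (φ : H p)), prod_smul_mem_graphA φ.2⟩
  map_add' φ ψ := by
    ext1
    simp only [Submodule.coe_add, smul_add, Prod.mk_add_mk]
  map_smul' c φ := by
    ext1
    simp only [Submodule.coe_smul, RingHom.id_apply, Prod.smul_mk, smul_comm c]

theorem toGraph_fst {p : Params} {lam : ℝ} (φ : eigenspaceA p lam) :
    (toGraph p lam φ).1.1 = φ := rfl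

/-- An eigenvector with vanishing Cauchy data at `0` vanishes. -/
theorem eq_zero_of_cauchy_data {p : Params} {lam : ℝ} {φ : H p} {u v w : ℝ → ℂ}
    (h : GraphRep p φ ((lam : ℂ) • φ) u v w) (hu0 : u 0 = 0) (hv0 : v 0 = 0) : φ = 0 := by
  have hℓ := p.ℓ_pos
  set k : ℂ := (p.m : ℂ) ^ 2 - lam with hk
  have hw : ∀ᵐ z ∂p.μ, w z = k * u z := by
    filter_upwards [h.bulk_eq, h.bulk_op, Lp.coeFn_smul (lam : ℂ) (bulk φ)] with z a b c
    have c' : (lam : ℂ) • bulk φ z = -w z + (p.m : ℂ) ^ 2 * u z := by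
      rw [← b]
      exact c.symm
    rw [a, smul_eq_mul] at c'
    rw [hk]
    linear_combination c'
  -- The relation v' = k u holds only almost everywhere. Replacing v by the integral V of k U makes
  -- (u, V) a genuine solution of a linear first-order system, to which a Grönwall argument applies.
  set U := extend p u h.continuousOn with hU
  have hUu : ∀ z ∈ Icc 0 p.ℓ, U z = u z := fun z hz => by
    rw [hU, extend_apply, projIcc_of_mem _ hz]
  set V : ℝ → ℂ := fun z => ∫ y in (0 : ℝ)..z, k * U y with hV
  have hVd : ∀ z, HasDerivAt V (k * U z) z := fun z =>
    (continuous_const.mul U.continuous).integral_hasStrictDerivAt 0 z |>.hasDerivAt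
  have hVv : ∀ z ∈ Icc 0 p.ℓ, V z = v z := by
    intro z hz
    have hsub : Ioo 0 z ⊆ Ioo 0 p.ℓ := Ioo_subset_Ioo_right hz.2
    have h1 : ∀ᵐ y ∂p.μ, HasDerivAt v (k * U y) y := by
      filter_upwards [h.hasDeriv_deriv, hw, ae_mem_Ioo p] with y a b hy
      rw [hUu y (Ioo_subset_Icc_self hy), ← b]
      exact a
    have h2 := (AbsolutelyContinuousOnInterval.integral_eq_sub_of_ae_hasDerivAt_complex hz.1
      (h.ac_deriv.mono (by
        rw [uIcc_of_le hz.1, uIcc_of_le hℓ.le]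
        exact Icc_subset_Icc_right hz.2))
      (ae_restrict_of_ae_restrict_of_subset hsub h1)).2
    rw [hv0, sub_zero] at h2
    exact h2
  have hVc : ContinuousOn V (Icc 0 p.ℓ) := fun z _ => (hVd z).continuousAt.continuousWithinAt
  have key := eq_zero_of_abs_deriv_le_mul_abs_self_of_eq_zero_right
    (f := fun z => (u z, V z)) (f' := fun z => (v z, k * U z)) (K := max 1 ‖k‖) (a := 0)
    (b := p.ℓ) (h.continuousOn.prodMk hVc) (fun z hz => by
      refine HasDerivWithinAt.prodMk ?_ (hVd z).hasDerivWithinAt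
      have := h.hasDeriv z (Ico_subset_Icc_self hz)
      exact this.mono_of_mem_nhdsWithin (Icc_mem_nhdsGE_of_mem hz)) (by
      simp [hu0, hV]) (fun z hz => by
      have hz' := Ico_subset_Icc_self hz
      rw [← hVv z hz', hUu z hz', Prod.norm_mk, Prod.norm_mk]
      refine max_le ?_ ?_
      · calc ‖V z‖ = 1 * ‖V z‖ := (one_mul _).symm
          _ ≤ _ := mul_le_mul (le_max_left _ _) (le_max_right _ _) (norm_nonneg _) (by positivity)
      · rw [norm_mul]
        exact mul_le_mul (le_max_right _ _) (le_max_left _ _) (norm_nonneg _) (by positivity))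
  have hu : ∀ z ∈ Icc 0 p.ℓ, u z = 0 := fun z hz => congrArg Prod.fst (key z hz)
  have hv : ∀ z ∈ Icc 0 p.ℓ, v z = 0 := fun z hz =>
    (hVv z hz).symm.trans (congrArg Prod.snd (key z hz))
  have hr := right_mem_Icc.mpr hℓ.le
  have hb : bulk φ = 0 := by
    apply Lp.ext
    filter_upwards [h.bulk_eq, ae_mem_Ioo p, Lp.coeFn_zero ℂ 2 p.μ] with z a hz c
    rw [a, c, hu z (Ioo_subset_Icc_self hz)]
    rfl
  have hd : bdry φ = 0 := by
    rw [h.bdry_eq, hu _ hr, hv _ hr]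
    simp
  exact (WithLp.ofLp_injective 2) (Prod.ext hb hd)

/-- The value at 0 determines an eigenvector: if it vanishes, the Robin condition with sin α ≠ 0
kills the derivative too. Hence eigenspaces are closed, and the closure in `eigenproj` changes
nothing. -/
theorem finiteDimensional_eigenspaceA {p : Params} (hα : p.α ≠ 0) (lam : ℝ) :
    FiniteDimensional ℂ (eigenspaceA p lam) := by
  have hsin : (Real.sin p.α : ℂ) ≠ 0 := by
    exact_mod_cast
      (Real.sin_pos_of_pos_of_lt_pi (lt_of_le_of_ne p.α_mem.1 (Ne.symm hα)) p.α_mem.2).ne'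
  let T : eigenspaceA p lam →ₗ[ℂ] ℂ :=
    { toFun := fun φ => rep p (toGraph p lam φ) 0
      map_add' := fun φ ψ => by simp
      map_smul' := fun c φ => by simp }
  refine FiniteDimensional.of_injective T ((injective_iff_map_eq_zero T).mpr fun φ hφ => ?_)
  obtain ⟨u, v, w, hr, -, -, hu, -⟩ := exists_graphRep_rep (toGraph p lam φ)
  have hu0 : u 0 = 0 := (hu 0 (left_mem_Icc.mpr p.ℓ_pos.le)).symm.trans hφ
  have hv0 : v 0 = 0 := by
    have h := hr.robin
    rw [hu0, mul_zero, zero_add] at h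
    exact (mul_eq_zero.mp h).resolve_left hsin
  exact Subtype.ext (eq_zero_of_cauchy_data hr hu0 hv0)

theorem eigenproj_mem {p : Params} (hα : p.α ≠ 0) (lam : ℝ) (φ : H p) :
    eigenproj p lam φ ∈ eigenspaceA p lam := by
  have := finiteDimensional_eigenspaceA hα lam
  have hc : (eigenspaceA p lam).topologicalClosure = eigenspaceA p lam :=
    (Submodule.closed_of_finiteDimensional _).submodule_topologicalClosure_eq
  have h : eigenproj p lam φ ∈ (eigenspaceA p lam).topologicalClosure :=
    Submodule.starProjection_apply_mem _ _
  rwa [hc] at h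

theorem eigenproj_of_mem {p : Params} {lam : ℝ} {φ : H p} (h : φ ∈ eigenspaceA p lam) :
    eigenproj p lam φ = φ :=
  Submodule.starProjection_eq_self_iff.mpr (Submodule.le_topologicalClosure _ h)

theorem eigenspaceA_inner {p : Params} {lam mu : ℝ} (hne : lam ≠ mu) {φ ψ : H p}
    (hφ : φ ∈ eigenspaceA p lam) (hψ : ψ ∈ eigenspaceA p mu) : inner ℂ φ ψ = 0 := by
  obtain ⟨u, v, w, h⟩ := isGraph_iff.mp (mem_eigenspaceA.mp hφ)
  obtain ⟨u', v', w', h'⟩ := isGraph_iff.mp (mem_eigenspaceA.mp hψ)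
  have := h.inner_symm h'
  rw [inner_smul_left, inner_smul_right, Complex.conj_ofReal] at this
  have h2 : ((mu : ℂ) - lam) * inner ℂ φ ψ = 0 := by linear_combination this
  refine (mul_eq_zero.mp h2).resolve_left (sub_ne_zero.mpr ?_)
  exact_mod_cast hne.symm

theorem orthogonalFamily (p : Params) :
    OrthogonalFamily ℂ (fun lam : ℝ => eigenspaceA p lam)
      (fun lam => (eigenspaceA p lam).subtypeₗᵢ) :=
  fun _ _ hne φ ψ => eigenspaceA_inner hne φ.2 ψ.2

/-- Projections are self-adjoint, so ‖P φ‖² = (P φ, φ), which is zero by orthogonality of distinct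
eigenspaces. -/
theorem eigenproj_of_mem_of_ne {p : Params} (hα : p.α ≠ 0) {lam mu : ℝ} (hne : lam ≠ mu) {φ : H p}
    (h : φ ∈ eigenspaceA p mu) : eigenproj p lam φ = 0 := by
  have h1 := eigenproj_mem hα lam φ
  have h2 : inner ℂ (eigenproj p lam φ) (eigenproj p lam φ) = (0 : ℂ) := by
    have h3 : inner ℂ (eigenproj p lam (eigenproj p lam φ)) φ =
        inner ℂ (eigenproj p lam φ) (eigenproj p lam φ) :=
      Submodule.inner_starProjection_left_eq_right _ _ _
    rw [← h3, eigenproj_of_mem h1]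
    exact eigenspaceA_inner hne h1 h
  exact inner_self_eq_zero.mp h2

theorem IsPositive.pos {p : Params} (hA : IsPositive p) {lam : ℝ} {φ : H p}
    (h : φ ∈ eigenspaceA p lam) (h0 : φ ≠ 0) : 0 < lam := by
  obtain ⟨y, hy1, hy2⟩ := LinearPMap.mem_graph_iff _ |>.mp (show (φ, (lam : ℂ) • φ) ∈
    (opA p).graph from h)
  simp only at hy1 hy2
  have hy : y ≠ 0 := by
    rintro rfl
    exact h0 hy1.symm
  have := hA y hy
  rw [hy2, hy1, inner_smul_right, inner_self_eq_norm_sq_to_K] at this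
  have h2 : ((lam : ℂ) * (‖φ‖ : ℂ) ^ 2).re = lam * ‖φ‖ ^ 2 := by
    rw [← Complex.ofReal_pow, ← Complex.ofReal_mul, Complex.ofReal_re]
  have h3 : 0 < lam * ‖φ‖ ^ 2 := h2 ▸ this
  exact pos_of_mul_pos_left h3 (by positivity)

/-! ### Finite spectral sums and the spectral gap -/

section Sums

variable {p : Params} (s : Finset ℝ) (l : ∀ lam : ℝ, eigenspaceA p lam)

theorem sum_toGraph_fst : (∑ lam ∈ s, toGraph p lam (l lam)).1.1 = ∑ lam ∈ s, (l lam : H p) := by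
  rw [AddSubmonoidClass.coe_finsetSum, Prod.fst_sum]
  rfl

theorem sum_toGraph_snd : (∑ lam ∈ s, toGraph p lam (l lam)).1.2 =
    ∑ lam ∈ s, (((lam : ℂ) • l lam : eigenspaceA p lam) : H p) := by
  rw [AddSubmonoidClass.coe_finsetSum, Prod.snd_sum]
  rfl

theorem norm_sum_sq : ‖∑ lam ∈ s, (l lam : H p)‖ ^ 2 = ∑ lam ∈ s, ‖(l lam : H p)‖ ^ 2 :=
  (orthogonalFamily p).norm_sum l s

theorem norm_sum_toGraph_fst : ‖(∑ lam ∈ s, toGraph p lam (l lam)).1.1‖ ^ 2 =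
    ∑ lam ∈ s, ‖(l lam : H p)‖ ^ 2 := by
  rw [sum_toGraph_fst, norm_sum_sq]

theorem norm_sum_toGraph_snd : ‖(∑ lam ∈ s, toGraph p lam (l lam)).1.2‖ ^ 2 =
    ∑ lam ∈ s, lam ^ 2 * ‖(l lam : H p)‖ ^ 2 := by
  rw [sum_toGraph_snd, norm_sum_sq s fun lam => (lam : ℂ) • l lam]
  refine Finset.sum_congr rfl fun lam _ => ?_
  rw [Submodule.coe_smul, norm_smul, mul_pow, Complex.norm_real, Real.norm_eq_abs, sq_abs]

theorem inner_sum_toGraph : (inner ℂ (∑ lam ∈ s, toGraph p lam (l lam)).1.1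
    (∑ lam ∈ s, toGraph p lam (l lam)).1.2).re = ∑ lam ∈ s, lam * ‖(l lam : H p)‖ ^ 2 := by
  rw [sum_toGraph_fst, sum_toGraph_snd]
  have h := (orthogonalFamily p).inner_sum l (fun lam => (lam : ℂ) • l lam) s
  simp only [Submodule.coe_subtypeₗᵢ, Submodule.subtype_apply] at h
  rw [h, Complex.re_sum]
  refine Finset.sum_congr rfl fun lam _ => ?_
  rw [Submodule.coe_inner, Submodule.coe_smul, inner_smul_right, Complex.re_ofReal_mul]
  congr 1
  exact inner_self_eq_norm_sq (𝕜 := ℂ) (l lam : H p)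

end Sums

/-- Testing with c = conj a gives S² ≤ M S for S = ∑ |aᵢ|². This turns a bound on combinations of
eigenfunctions into a bound on the sum of their squares. -/
theorem sum_norm_sq_le_of_dual {ι : Type*} (s : Finset ι) (a : ι → ℂ) {M : ℝ} (hM : 0 ≤ M)
    (h : ∀ c : ι → ℂ, ‖∑ i ∈ s, c i * a i‖ ^ 2 ≤ M * ∑ i ∈ s, ‖c i‖ ^ 2) :
    ∑ i ∈ s, ‖a i‖ ^ 2 ≤ M := by
  have h1 := h fun i => conj (a i)
  set S := ∑ i ∈ s, ‖a i‖ ^ 2 with hS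
  have e : ∑ i ∈ s, conj (a i) * a i = (S : ℂ) := by
    rw [hS]
    push_cast
    exact Finset.sum_congr rfl fun i _ => Complex.conj_mul' _
  have hS0 : 0 ≤ S := Finset.sum_nonneg fun _ _ => by positivity
  simp only [RCLike.norm_conj] at h1
  rw [e, Complex.norm_real, Real.norm_eq_abs, sq_abs] at h1
  rcases hS0.eq_or_lt with h0 | h0
  · linarith
  · exact le_of_mul_le_mul_right (by linarith) h0

/-- The number of eigenvalues `≤ 1` is bounded. -/
theorem card_eigenvalues_le (p : Params) (hα : p.α ≠ 0) : ∃ N : ℝ, ∀ s : Finset ℝ,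
    (∀ lam ∈ s, lam ≤ 1 ∧ eigenspaceA p lam ≠ ⊥) → (s.card : ℝ) ≤ N := by
  obtain ⟨C, hC, hc⟩ := norm_rep_sq_le p hα
  have hρ : 0 < p.ρ := p.ρ_pos
  -- The cardinality is the sum of ‖e_λ‖² over unit eigenvectors. Pointwise ∑ |e_λ(z)|² ≤ 2 + C, as
  -- the form is at most the squared norm when λ ≤ 1; integrating over z gives ℓ (2 + C). The
  -- boundary components contribute at most 1.
  refine ⟨p.ℓ * (2 + C) + 1, fun s hs => ?_⟩
  have hex : ∀ lam : ℝ, ∃ e : eigenspaceA p lam, lam ∈ s → ‖(e : H p)‖ = 1 := by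
    intro lam
    by_cases hl : lam ∈ s
    · obtain ⟨x, hx, hx0⟩ := Submodule.exists_mem_ne_zero_of_ne_bot (hs lam hl).2
      refine ⟨((‖x‖⁻¹ : ℝ) : ℂ) • ⟨x, hx⟩, fun _ => ?_⟩
      rw [Submodule.coe_smul, norm_smul, Complex.norm_real, norm_inv, norm_norm]
      exact inv_mul_cancel₀ (norm_ne_zero_iff.mpr hx0)
    · exact ⟨0, fun h => absurd h hl⟩
  choose e he using hex
  have hn : ∀ c : ℝ → ℂ, ∑ lam ∈ s, ‖((c lam • e lam : eigenspaceA p lam) : H p)‖ ^ 2 =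
      ∑ lam ∈ s, ‖c lam‖ ^ 2 := fun c =>
    Finset.sum_congr rfl fun lam hl => by
      rw [Submodule.coe_smul, norm_smul, he lam hl, mul_one]
  have hbulk : ∀ z, ∑ lam ∈ s, ‖rep p (toGraph p lam (e lam)) z‖ ^ 2 ≤ 2 + C := by
    intro z
    refine sum_norm_sq_le_of_dual s _ (by positivity) fun c => ?_
    have h1 := hc (∑ lam ∈ s, toGraph p lam (c lam • e lam)) z
    rw [inner_sum_toGraph s fun lam => c lam • e lam,
      norm_sum_toGraph_fst s fun lam => c lam • e lam, hn] at h1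
    have h2 : ∑ lam ∈ s, lam * ‖((c lam • e lam : eigenspaceA p lam) : H p)‖ ^ 2 ≤
        ∑ lam ∈ s, ‖c lam‖ ^ 2 := by
      rw [← hn]
      exact Finset.sum_le_sum fun lam hl =>
        mul_le_of_le_one_left (by positivity) (hs lam hl).1
    have h3 : rep p (∑ lam ∈ s, toGraph p lam (c lam • e lam)) z =
        ∑ lam ∈ s, c lam * rep p (toGraph p lam (e lam)) z := by
      simp [map_sum, BoundedContinuousFunction.coe_sum]
    rw [h3] at h1
    linarith
  have hbdry : ∑ lam ∈ s, ‖bdry (e lam : H p)‖ ^ 2 ≤ p.ρ := by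
    refine sum_norm_sq_le_of_dual s _ hρ.le fun c => ?_
    have h1 := bdry_sq_le (∑ lam ∈ s, ((c lam • e lam : eigenspaceA p lam) : H p))
    rw [norm_sum_sq s fun lam => c lam • e lam, hn] at h1
    let B : H p →ₗ[ℂ] ℂ := ⟨⟨bdry, fun _ _ => rfl⟩, fun _ _ => rfl⟩
    have h3 : bdry (∑ lam ∈ s, ((c lam • e lam : eigenspaceA p lam) : H p)) =
        ∑ lam ∈ s, c lam * bdry (e lam : H p) := by
      change B _ = ∑ lam ∈ s, c lam * B (e lam)
      simp
    rwa [h3] at h1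
  have hsum : (s.card : ℝ) = ∑ lam ∈ s, ‖(e lam : H p)‖ ^ 2 := by
    rw [Finset.sum_congr rfl fun lam hl => by rw [he lam hl, one_pow]]
    simp
  rw [hsum]
  simp_rw [norm_sq_eq]
  rw [Finset.sum_add_distrib, ← Finset.mul_sum]
  have hint : ∀ lam : ℝ, IntegrableOn (fun z => ‖rep p (toGraph p lam (e lam)) z‖ ^ 2)
      (Ioo 0 p.ℓ) := fun lam =>
    (((rep p (toGraph p lam (e lam))).continuous.norm.pow 2).integrableOn_Icc).mono_set
      Ioo_subset_Icc_self
  have k1 : ∑ lam ∈ s, ∫ z, ‖bulk (e lam : H p) z‖ ^ 2 ∂p.μ ≤ p.ℓ * (2 + C) := by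
    have h1 : ∀ lam ∈ s, ∫ z, ‖bulk (e lam : H p) z‖ ^ 2 ∂p.μ =
        ∫ z in Ioo 0 p.ℓ, ‖rep p (toGraph p lam (e lam)) z‖ ^ 2 := by
      intro lam _
      refine integral_congr_ae ?_
      have h2 := toLp_rep (toGraph p lam (e lam))
      rw [toGraph_fst] at h2
      rw [← h2]
      filter_upwards [BoundedContinuousFunction.coeFn_toLp p.μ ℂ (rep p (toGraph p lam (e lam)))
        (p := 2)] with z a
      rw [a]
    rw [Finset.sum_congr rfl h1, ← integral_finsetSum _ fun lam _ => hint lam]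
    have h3 : ∫ _ in Ioo 0 p.ℓ, (2 + C) = p.ℓ * (2 + C) := by simp [p.ℓ_pos.le]
    rw [← h3]
    exact integral_mono (integrable_finsetSum _ fun lam _ => hint lam) (by simp) hbulk
  have k2 : p.ρ⁻¹ * ∑ lam ∈ s, ‖bdry (e lam : H p)‖ ^ 2 ≤ 1 := by
    rw [inv_mul_le_iff₀ hρ, mul_one]
    exact hbdry
  exact add_le_add k1 k2

/-- The eigenvalues of a positive `A` are bounded away from `0`. -/
theorem spectral_gap {p : Params} (hα : p.α ≠ 0) (hA : IsPositive p) :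
    ∃ lam₀ : ℝ, 0 < lam₀ ∧ ∀ lam, eigenspaceA p lam ≠ ⊥ → lam₀ ≤ lam := by
  obtain ⟨N, hN⟩ := card_eigenvalues_le p hα
  have hfin : {lam : ℝ | lam ≤ 1 ∧ eigenspaceA p lam ≠ ⊥}.Finite := by
    by_contra hinf
    obtain ⟨s, hs, hcard⟩ := Set.Infinite.exists_subset_card_eq hinf (⌊N⌋₊ + 1)
    have h1 := hN s fun lam hl => hs hl
    rw [hcard] at h1
    have := Nat.lt_floor_add_one N
    push_cast at h1
    linarith
  -- Inserting 1 makes the set nonempty and takes care of the eigenvalues above 1.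
  obtain ⟨lam₀, hmem, hmin⟩ := Finset.exists_min_image (insert 1 hfin.toFinset) id
    (Finset.insert_nonempty _ _)
  have hpos : 0 < lam₀ := by
    rcases Finset.mem_insert.mp hmem with h | h
    · rw [h]
      exact one_pos
    · obtain ⟨x, hx, hx0⟩ := Submodule.exists_mem_ne_zero_of_ne_bot (hfin.mem_toFinset.mp h).2
      exact hA.pos hx hx0
  refine ⟨lam₀, hpos, fun lam hl => ?_⟩
  by_cases h1 : lam ≤ 1
  · exact hmin lam (Finset.mem_insert_of_mem (hfin.mem_toFinset.mpr ⟨h1, hl⟩))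
  · exact (hmin 1 (Finset.mem_insert_self _ _)).trans (not_le.mp h1).le

/-! ### Functional calculus by spectral sums -/

variable {p : Params}

/-- The component of a vector in an eigenspace. -/
def eigencomp (hα : p.α ≠ 0) (lam : ℝ) : H p →ₗ[ℂ] eigenspaceA p lam :=
  LinearMap.codRestrict _ (eigenproj p lam).toLinearMap (eigenproj_mem hα lam)

theorem coe_eigencomp (hα : p.α ≠ 0) (lam : ℝ) (φ : H p) :
    (eigencomp hα lam φ : H p) = eigenproj p lam φ := rfl

theorem norm_sum_smul_eigenproj_sq (hα : p.α ≠ 0) (s : Finset ℝ) (g : ℝ → ℝ) (φ : H p) :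
    ‖∑ lam ∈ s, (g lam : ℂ) • eigenproj p lam φ‖ ^ 2 =
      ∑ lam ∈ s, g lam ^ 2 * ‖eigenproj p lam φ‖ ^ 2 := by
  have h := norm_sum_sq s fun lam => (g lam : ℂ) • eigencomp hα lam φ
  simp only [Submodule.coe_smul, coe_eigencomp] at h
  rw [h]
  refine Finset.sum_congr rfl fun lam _ => ?_
  rw [norm_smul, mul_pow, Complex.norm_real, Real.norm_eq_abs, sq_abs]

theorem norm_sum_eigenproj_sq (hα : p.α ≠ 0) (s : Finset ℝ) (φ : H p) :
    ‖∑ lam ∈ s, eigenproj p lam φ‖ ^ 2 = ∑ lam ∈ s, ‖eigenproj p lam φ‖ ^ 2 := by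
  simpa using norm_sum_smul_eigenproj_sq hα s (fun _ => 1) φ

theorem inner_eigenproj_self (hα : p.α ≠ 0) (lam : ℝ) (φ : H p) :
    inner ℂ (eigenproj p lam φ) φ = ((‖eigenproj p lam φ‖ ^ 2 : ℝ) : ℂ) := by
  have h3 : inner ℂ (eigenproj p lam (eigenproj p lam φ)) φ =
      inner ℂ (eigenproj p lam φ) (eigenproj p lam φ) :=
    Submodule.inner_starProjection_left_eq_right _ _ _
  rw [eigenproj_of_mem (eigenproj_mem hα lam φ)] at h3
  rw [h3, inner_self_eq_norm_sq_to_K]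
  norm_cast

/-- Bessel's inequality. -/
theorem norm_sum_eigenproj_le (hα : p.α ≠ 0) (s : Finset ℝ) (φ : H p) :
    ‖∑ lam ∈ s, eigenproj p lam φ‖ ≤ ‖φ‖ := by
  set S := ∑ lam ∈ s, eigenproj p lam φ with hS
  have h1 : inner ℂ S φ = ((‖S‖ ^ 2 : ℝ) : ℂ) := by
    rw [hS, norm_sum_eigenproj_sq hα, sum_inner, Complex.ofReal_sum]
    exact Finset.sum_congr rfl fun lam _ => inner_eigenproj_self hα lam φ
  have h2 := norm_inner_le_norm (𝕜 := ℂ) S φ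
  rw [h1, Complex.norm_real, Real.norm_eq_abs, abs_of_nonneg (sq_nonneg _), sq] at h2
  rcases (norm_nonneg S).eq_or_lt with h0 | h0
  · rw [← h0]
    exact norm_nonneg φ
  · exact le_of_mul_le_mul_left h2 h0

theorem summable_smul_eigenproj (hα : p.α ≠ 0) {g : ℝ → ℝ} {φ : H p} (h : φ ∈ funDomain p g) :
    Summable fun lam : ℝ => (g lam : ℂ) • eigenproj p lam φ := by
  have h1 := (orthogonalFamily p).summable_iff_norm_sq_summable
    fun lam => (g lam : ℂ) • eigencomp hα lam φ
  refine h1.mpr (h.congr fun lam => ?_)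
  rw [norm_smul, mul_pow, Complex.norm_real, Real.norm_eq_abs, sq_abs]
  rfl

theorem summable_eigenproj (hα : p.α ≠ 0) (φ : H p) : Summable fun lam => eigenproj p lam φ := by
  have h : φ ∈ funDomain p fun _ => 1 := by
    refine summable_of_sum_le (c := ‖φ‖ ^ 2) (fun _ => by positivity) fun s => ?_
    simp only [one_pow, one_mul]
    rw [← norm_sum_eigenproj_sq hα]
    exact pow_le_pow_left₀ (norm_nonneg _) (norm_sum_eigenproj_le hα s φ) 2
  simpa using summable_smul_eigenproj hα h

/-- A family of linear maps controlled by the spectral projections sums to a bounded operator. -/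
theorem exists_clm_hasSum (hα : p.α ≠ 0) {B : Type*} [NormedAddCommGroup B] [NormedSpace ℂ B]
    [CompleteSpace B] (T : ℝ → H p →ₗ[ℂ] B) {C : ℝ} (hC : 0 ≤ C)
    (h : ∀ (s : Finset ℝ) (φ : H p),
      ‖∑ lam ∈ s, T lam φ‖ ≤ C * ‖∑ lam ∈ s, eigenproj p lam φ‖) :
    ∃ G : H p →L[ℂ] B, (∀ φ, HasSum (fun lam => T lam φ) (G φ)) ∧ ∀ φ, ‖G φ‖ ≤ C * ‖φ‖ := by
  have hs : ∀ φ, Summable fun lam => T lam φ := by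
    intro φ
    rw [summable_iff_vanishing_norm]
    intro ε hε
    -- The Cauchy criterion passes from ∑ P_λ φ to ∑ T_λ φ; C + 1 replaces C because C may be 0.
    obtain ⟨s, hs⟩ := summable_iff_vanishing_norm.mp (summable_eigenproj hα φ) (ε / (C + 1))
      (by positivity)
    refine ⟨s, fun t ht => ?_⟩
    have h1 := hs t ht
    rw [lt_div_iff₀ (by positivity)] at h1
    nlinarith [h t φ, norm_nonneg (∑ lam ∈ t, eigenproj p lam φ)]
  let L : H p →ₗ[ℂ] B :=
    { toFun := fun φ => ∑' lam, T lam φ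
      map_add' := fun φ ψ => by
        simp only [map_add]
        exact (hs φ).tsum_add (hs ψ)
      map_smul' := fun c φ => by
        simp only [map_smul, RingHom.id_apply]
        exact (hs φ).tsum_const_smul c }
  have hb : ∀ φ, ‖L φ‖ ≤ C * ‖φ‖ := fun φ =>
    le_of_tendsto (hs φ).hasSum.norm (Filter.Eventually.of_forall fun s =>
      (h s φ).trans (mul_le_mul_of_nonneg_left (norm_sum_eigenproj_le hα s φ) hC))
  exact ⟨L.mkContinuous C hb, fun φ => (hs φ).hasSum, hb⟩

/-- `G = g(A)`, as a bounded operator. -/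
def IsFun (p : Params) (g : ℝ → ℝ) (G : H p →L[ℂ] H p) : Prop :=
  ∀ φ, HasSum (fun lam => (g lam : ℂ) • eigenproj p lam φ) (G φ)

theorem eigenproj_eq_zero (hα : p.α ≠ 0) {lam : ℝ} (h : eigenspaceA p lam = ⊥) (φ : H p) :
    eigenproj p lam φ = 0 := by
  have := eigenproj_mem hα lam φ
  rwa [h, Submodule.mem_bot] at this

/-- P_λ vanishes unless λ is an eigenvalue, so g need only be bounded there. This admits λ^{-1/2},
unbounded near 0, thanks to the spectral gap. -/
theorem exists_isFun (hα : p.α ≠ 0) {g : ℝ → ℝ} {M : ℝ} (hM : 0 ≤ M)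
    (hg : ∀ lam, eigenspaceA p lam ≠ ⊥ → |g lam| ≤ M) :
    ∃ G : H p →L[ℂ] H p, IsFun p g G ∧ ∀ φ, ‖G φ‖ ≤ M * ‖φ‖ := by
  refine exists_clm_hasSum hα (fun lam => (g lam : ℂ) • (eigenproj p lam).toLinearMap) hM
    fun s φ => ?_
  refine le_of_sq_le_sq ?_ (by positivity)
  rw [mul_pow, norm_sum_eigenproj_sq hα, Finset.mul_sum]
  refine (norm_sum_smul_eigenproj_sq hα s g φ).trans_le (Finset.sum_le_sum fun lam _ => ?_)
  by_cases h : eigenspaceA p lam = ⊥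
  · rw [eigenproj_eq_zero hα h]
    simp
  · refine mul_le_mul_of_nonneg_right ?_ (by positivity)
    rw [← sq_abs]
    exact pow_le_pow_left₀ (abs_nonneg _) (hg lam h) 2

theorem hasSum_smul_eigenproj_of_mem (hα : p.α ≠ 0) (g : ℝ → ℝ) {lam : ℝ} {φ : H p}
    (h : φ ∈ eigenspaceA p lam) :
    HasSum (fun mu => (g mu : ℂ) • eigenproj p mu φ) ((g lam : ℂ) • φ) := by
  have := hasSum_single (f := fun mu => (g mu : ℂ) • eigenproj p mu φ) lam fun mu hne => by
    rw [eigenproj_of_mem_of_ne hα hne h, smul_zero]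
  simpa only [eigenproj_of_mem h] using this

/-- The spectral components of `g(A) φ`. -/
theorem eigenproj_hasSum (hα : p.α ≠ 0) {g : ℝ → ℝ} {φ ψ : H p}
    (h : HasSum (fun lam => (g lam : ℂ) • eigenproj p lam φ) ψ) (lam : ℝ) :
    eigenproj p lam ψ = (g lam : ℂ) • eigenproj p lam φ := by
  have h1 := h.mapL (eigenproj p lam)
  simp only [map_smul] at h1
  have h2 := hasSum_single (f := fun mu => (g mu : ℂ) • eigenproj p lam (eigenproj p mu φ)) lam
    fun mu hne => by
      rw [eigenproj_of_mem_of_ne hα hne.symm (eigenproj_mem hα mu φ), smul_zero]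
  rw [eigenproj_of_mem (eigenproj_mem hα lam φ)] at h2
  exact h1.unique h2

namespace IsFun

variable {g k : ℝ → ℝ} {G K : H p →L[ℂ] H p}

/-- The inner function k enters only through convergence at the single vector φ, so unbounded
functions such as the square root are allowed. -/
theorem comp_apply (hα : p.α ≠ 0) (h : IsFun p g G) {φ ψ : H p}
    (hk : HasSum (fun lam => (k lam : ℂ) • eigenproj p lam φ) ψ) :
    HasSum (fun lam => ((g lam * k lam : ℝ) : ℂ) • eigenproj p lam φ) (G ψ) := by
  refine (h ψ).congr_fun fun lam => ?_
  rw [eigenproj_hasSum hα hk, smul_smul, Complex.ofReal_mul]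

theorem apply_of_mem (hα : p.α ≠ 0) (h : IsFun p g G) {lam : ℝ} {φ : H p}
    (hφ : φ ∈ eigenspaceA p lam) : G φ = (g lam : ℂ) • φ :=
  (h φ).unique (hasSum_smul_eigenproj_of_mem hα g hφ)

end IsFun

/-- Uniformly bounded functions of `A` are uniform limits of their finite parts. -/
theorem tendstoUniformly_sum (hα : p.α ≠ 0) {g : ℝ → ℝ → ℝ} {G : ℝ → H p →L[ℂ] H p}
    (hG : ∀ t, IsFun p (g t) (G t)) (hn : ∀ t φ, ‖G t φ‖ ≤ ‖φ‖) (φ : H p) :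
    TendstoUniformly (fun (s : Finset ℝ) t => ∑ lam ∈ s, (g t lam : ℂ) • eigenproj p lam φ)
      (fun t => G t φ) Filter.atTop := by
  rw [Metric.tendstoUniformly_iff]
  intro ε hε
  obtain ⟨ψ, hψ⟩ := summable_eigenproj hα φ
  filter_upwards [Metric.tendsto_nhds.mp hψ ε hε] with s hs t
  have h1 : G t ψ = G t φ := by
    have h2 := (hG t).comp_apply hα (k := fun _ => 1) (φ := φ) (ψ := ψ) (by simpa using hψ)
    simp only [mul_one] at h2
    exact h2.unique (hG t φ)
  have h2 : G t (∑ lam ∈ s, eigenproj p lam φ) =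
      ∑ lam ∈ s, (g t lam : ℂ) • eigenproj p lam φ := by
    rw [map_sum]
    exact Finset.sum_congr rfl fun lam _ =>
      (hG t).apply_of_mem hα (eigenproj_mem hα lam φ)
  rw [← h1, ← h2, dist_eq_norm, ← map_sub]
  refine (hn t _).trans_lt ?_
  rwa [← dist_eq_norm, dist_comm]

theorem continuous_apply (hα : p.α ≠ 0) {g : ℝ → ℝ → ℝ} {G : ℝ → H p →L[ℂ] H p}
    (hG : ∀ t, IsFun p (g t) (G t)) (hn : ∀ t φ, ‖G t φ‖ ≤ ‖φ‖)
    (hg : ∀ lam, Continuous fun t => g t lam) (φ : H p) : Continuous fun t => G t φ :=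
  (tendstoUniformly_sum hα hG hn φ).continuous (Filter.Frequently.of_forall fun s =>
    continuous_finsetSum s fun lam _ =>
      (Complex.continuous_ofReal.comp (hg lam)).smul continuous_const)

theorem continuous_apply_apply {G : ℝ → H p →L[ℂ] H p} (hn : ∀ t φ, ‖G t φ‖ ≤ ‖φ‖)
    (hc : ∀ φ, Continuous fun t => G t φ) {f : ℝ → H p} (hf : Continuous f) :
    Continuous fun t => G t (f t) := by
  rw [continuous_iff_continuousAt]
  intro t₀
  have h1 : Filter.Tendsto (fun t => ‖f t - f t₀‖) (nhds t₀) (nhds 0) := by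
    have := ((hf.sub continuous_const).norm.tendsto t₀ :
      Filter.Tendsto (fun t => ‖f t - f t₀‖) _ _)
    simpa using this
  have h2 : Filter.Tendsto (fun t => G t (f t - f t₀)) (nhds t₀) (nhds 0) :=
    squeeze_zero_norm (fun t => hn t _) h1
  have h3 := h2.add ((hc (f t₀)).tendsto t₀)
  simpa [ContinuousAt] using h3

/-- The derivatives of the finite sums converge uniformly in t, so differentiation passes to the
limit. The scalar derivative is asked for only at eigenvalues: sin(√λ t)/√λ has the wrong derivative
when √λ = 0. -/
theorem hasDerivAt_apply (hα : p.α ≠ 0) {g g' : ℝ → ℝ → ℝ} {G : ℝ → H p} {G' : ℝ → H p →L[ℂ] H p}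
    (hG' : ∀ t, IsFun p (g' t) (G' t)) (hn : ∀ t φ, ‖G' t φ‖ ≤ ‖φ‖) (φ : H p)
    (hG : ∀ t, HasSum (fun lam => (g t lam : ℂ) • eigenproj p lam φ) (G t))
    (hg : ∀ lam, eigenspaceA p lam ≠ ⊥ → ∀ t, HasDerivAt (fun t => g t lam) (g' t lam) t) (t : ℝ) :
    HasDerivAt G (G' t φ) t := by
  refine hasDerivAt_of_tendstoUniformly (tendstoUniformly_sum hα hG' hn φ)
    (Filter.Eventually.of_forall fun s t => ?_) hG t
  refine HasDerivAt.fun_sum fun lam _ => ?_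
  by_cases h : eigenspaceA p lam = ⊥
  · simp only [eigenproj_eq_zero hα h, smul_zero]
    exact hasDerivAt_const _ _
  · exact ((hg lam h t).ofReal_comp).smul_const _

/-! ### From Hilbert space norms to sup norms -/

theorem sum_smul_toGraph (hα : p.α ≠ 0) (s : Finset ℝ) (g : ℝ → ℝ) (φ : H p) :
    ∑ lam ∈ s, (g lam : ℂ) • toGraph p lam (eigencomp hα lam φ) =
      ∑ lam ∈ s, toGraph p lam ((g lam : ℂ) • eigencomp hα lam φ) :=
  Finset.sum_congr rfl fun lam _ => ((toGraph p lam).map_smul _ _).symm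

theorem norm_sq_smul_eigencomp (hα : p.α ≠ 0) (g : ℝ → ℝ) (lam : ℝ) (φ : H p) :
    ‖(((g lam : ℂ) • eigencomp hα lam φ : eigenspaceA p lam) : H p)‖ ^ 2 =
      g lam ^ 2 * ‖eigenproj p lam φ‖ ^ 2 := by
  rw [Submodule.coe_smul, norm_smul, mul_pow, Complex.norm_real, Real.norm_eq_abs, sq_abs]
  rfl

/-- A termwise bound for spectral sums, which need only be checked on eigenvalues. -/
theorem sum_mul_norm_eigenproj_sq_le (hα : p.α ≠ 0) (s : Finset ℝ) {b : ℝ → ℝ} {M : ℝ} (φ : H p)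
    (hb : ∀ lam, eigenspaceA p lam ≠ ⊥ → b lam ≤ M) :
    ∑ lam ∈ s, b lam * ‖eigenproj p lam φ‖ ^ 2 ≤ M * ‖∑ lam ∈ s, eigenproj p lam φ‖ ^ 2 := by
  rw [norm_sum_eigenproj_sq hα, Finset.mul_sum]
  refine Finset.sum_le_sum fun lam _ => ?_
  by_cases h : eigenspaceA p lam = ⊥
  · rw [eigenproj_eq_zero hα h]
    simp
  · exact mul_le_mul_of_nonneg_right (hb lam h) (by positivity)

/-- The representative of `A^{-1/2} φ`. -/
theorem exists_rep_clm (hα : p.α ≠ 0) (hA : IsPositive p) : ∃ J : H p →L[ℂ] (ℝ →ᵇ ℂ), ∀ φ,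
    HasSum (fun lam : ℝ => ((Real.sqrt lam)⁻¹ : ℂ) • rep p (toGraph p lam (eigencomp hα lam φ)))
      (J φ) := by
  obtain ⟨lam₀, hpos, hgap⟩ := spectral_gap hα hA
  obtain ⟨C, hC, hc⟩ := norm_rep_sq_le p hα
  -- With coefficients λ^{-1/2}, the form contributes 2 λ · λ⁻¹ = 2 and the norm at most C/λ₀.
  set M := 2 + C * lam₀⁻¹ with hM
  have hM0 : 0 ≤ M := by positivity
  let T : ℝ → H p →ₗ[ℂ] (ℝ →ᵇ ℂ) := fun lam =>
    (((Real.sqrt lam)⁻¹ : ℝ) : ℂ) • (rep p).comp ((toGraph p lam).comp (eigencomp hα lam))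
  obtain ⟨J, hJ, -⟩ := exists_clm_hasSum hα T (Real.sqrt_nonneg M) fun s φ => by
    refine BoundedContinuousFunction.norm_le (by positivity) |>.mpr fun z => ?_
    refine le_of_sq_le_sq ?_ (by positivity)
    rw [mul_pow, Real.sq_sqrt hM0]
    have e : ∑ lam ∈ s, T lam φ =
        rep p (∑ lam ∈ s, toGraph p lam ((((Real.sqrt lam)⁻¹ : ℝ) : ℂ) • eigencomp hα lam φ)) := by
      rw [← sum_smul_toGraph hα s fun lam => (Real.sqrt lam)⁻¹, map_sum]
      exact Finset.sum_congr rfl fun lam _ => ((rep p).map_smul _ _).symm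
    rw [e]
    refine (hc _ z).trans ?_
    rw [inner_sum_toGraph s fun lam => (((Real.sqrt lam)⁻¹ : ℝ) : ℂ) • eigencomp hα lam φ,
      norm_sum_toGraph_fst s fun lam => (((Real.sqrt lam)⁻¹ : ℝ) : ℂ) • eigencomp hα lam φ]
    simp_rw [norm_sq_smul_eigencomp hα fun lam => (Real.sqrt lam)⁻¹]
    rw [Finset.mul_sum, Finset.mul_sum, ← Finset.sum_add_distrib]
    refine le_trans (le_of_eq ?_) (sum_mul_norm_eigenproj_sq_le hα s
      (b := fun lam => 2 * (lam * (Real.sqrt lam)⁻¹ ^ 2) + C * (Real.sqrt lam)⁻¹ ^ 2) φ ?_)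
    · exact Finset.sum_congr rfl fun lam _ => by ring
    · intro lam hl
      have hl' := hgap lam hl
      have hl0 : 0 < lam := hpos.trans_le hl'
      rw [inv_pow, Real.sq_sqrt hl0.le, mul_inv_cancel₀ hl0.ne', hM, mul_one]
      gcongr
  refine ⟨J, fun φ => ?_⟩
  have := hJ φ
  simpa only [T, LinearMap.smul_apply, LinearMap.comp_apply, Complex.ofReal_inv] using this

/-- The derivative of the representative of `A⁻¹ φ`. -/
theorem exists_repDeriv_clm (hα : p.α ≠ 0) (hA : IsPositive p) : ∃ K : H p →L[ℂ] (ℝ →ᵇ ℂ), ∀ φ,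
    HasSum (fun lam : ℝ => (lam⁻¹ : ℂ) • repDeriv p (toGraph p lam (eigencomp hα lam φ)))
      (K φ) := by
  obtain ⟨lam₀, hpos, hgap⟩ := spectral_gap hα hA
  obtain ⟨C, hC, hc⟩ := norm_repDeriv_sq_le p hα
  -- With coefficients λ⁻¹, the norm of A⁻¹ φ contributes at most λ₀⁻², and that of A A⁻¹ φ
  -- contributes 1.
  set M := C * (lam₀⁻¹ ^ 2 + 1) with hM
  have hM0 : 0 ≤ M := by positivity
  let T : ℝ → H p →ₗ[ℂ] (ℝ →ᵇ ℂ) := fun lam =>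
    ((lam⁻¹ : ℝ) : ℂ) • (repDeriv p).comp ((toGraph p lam).comp (eigencomp hα lam))
  obtain ⟨K, hK, -⟩ := exists_clm_hasSum hα T (Real.sqrt_nonneg M) fun s φ => by
    refine BoundedContinuousFunction.norm_le (by positivity) |>.mpr fun z => ?_
    refine le_of_sq_le_sq ?_ (by positivity)
    rw [mul_pow, Real.sq_sqrt hM0]
    have e : ∑ lam ∈ s, T lam φ =
        repDeriv p (∑ lam ∈ s, toGraph p lam (((lam⁻¹ : ℝ) : ℂ) • eigencomp hα lam φ)) := by
      rw [← sum_smul_toGraph hα s fun lam => lam⁻¹, map_sum]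
      exact Finset.sum_congr rfl fun lam _ => ((repDeriv p).map_smul _ _).symm
    rw [e]
    refine (hc _ z).trans ?_
    rw [norm_sum_toGraph_snd s fun lam => ((lam⁻¹ : ℝ) : ℂ) • eigencomp hα lam φ,
      norm_sum_toGraph_fst s fun lam => ((lam⁻¹ : ℝ) : ℂ) • eigencomp hα lam φ]
    simp_rw [norm_sq_smul_eigencomp hα fun lam => lam⁻¹]
    rw [← Finset.sum_add_distrib, Finset.mul_sum]
    refine le_trans (le_of_eq ?_) (sum_mul_norm_eigenproj_sq_le hα s
      (b := fun lam => C * (lam⁻¹ ^ 2 + lam ^ 2 * lam⁻¹ ^ 2)) φ ?_)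
    · exact Finset.sum_congr rfl fun lam _ => by ring
    · intro lam hl
      have hl' := hgap lam hl
      have hl0 : 0 < lam := hpos.trans_le hl'
      rw [← mul_pow lam, mul_inv_cancel₀ hl0.ne', hM, one_pow]
      gcongr
  refine ⟨K, fun φ => ?_⟩
  have := hK φ
  simpa only [T, LinearMap.smul_apply, LinearMap.comp_apply, Complex.ofReal_inv] using this

/-- The first component, as a bounded operator. -/
def bulkL (p : Params) : H p →L[ℂ] Lp ℂ 2 p.μ := WithLp.fstL 2 ℂ _ _

/-- The second component, as a bounded operator. -/
def bdryL (p : Params) : H p →L[ℂ] ℂ :=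
  LinearMap.mkContinuous ⟨⟨bdry, fun _ _ => rfl⟩, fun _ _ => rfl⟩ (Real.sqrt p.ρ) fun φ => by
    have hρ : 0 < p.ρ := p.ρ_pos
    refine le_of_sq_le_sq ?_ (by positivity)
    rw [mul_pow, Real.sq_sqrt hρ.le]
    exact bdry_sq_le φ

/-- Integration over `[0, z]`, as a bounded operator. -/
def integralL (z : ℝ) : (ℝ →ᵇ ℂ) →L[ℂ] ℂ :=
  LinearMap.mkContinuous
    { toFun := fun b => ∫ y in (0 : ℝ)..z, b y
      map_add' := fun b c => intervalIntegral.integral_add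
        (b.continuous.intervalIntegrable _ _) (c.continuous.intervalIntegrable _ _)
      map_smul' := fun c b => intervalIntegral.integral_smul c b } |z| fun b => by
    have := intervalIntegral.norm_integral_le_of_norm_le_const (a := 0) (b := z) (f := b)
      fun y _ => b.norm_coe_le_norm y
    rw [sub_zero, mul_comm] at this
    exact this

theorem integralL_apply (z : ℝ) (b : ℝ →ᵇ ℂ) : integralL z b = ∫ y in (0 : ℝ)..z, b y := rfl

section Representatives

variable (hα : p.α ≠ 0) {J K : H p →L[ℂ] (ℝ →ᵇ ℂ)} {R : H p →L[ℂ] H p}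
  (hJ : ∀ φ, HasSum
    (fun lam : ℝ => ((Real.sqrt lam)⁻¹ : ℂ) • rep p (toGraph p lam (eigencomp hα lam φ))) (J φ))
  (hK : ∀ φ, HasSum
    (fun lam : ℝ => (lam⁻¹ : ℂ) • repDeriv p (toGraph p lam (eigencomp hα lam φ))) (K φ))
  (hR : IsFun p (fun lam => (Real.sqrt lam)⁻¹) R)
include hJ hR

/-- The same series converges uniformly to J φ and in L² to the first component of R φ; the
inclusion into L² is continuous, so the limits coincide. -/
theorem bulk_ae_eq (φ : H p) : bulk (R φ) =ᵐ[p.μ] J φ := by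
  have h1 := (hJ φ).mapL (BoundedContinuousFunction.toLp 2 p.μ ℂ)
  have h2 := (hR φ).mapL (bulkL p)
  have h3 : BoundedContinuousFunction.toLp 2 p.μ ℂ (J φ) = bulk (R φ) := by
    refine h1.unique (h2.congr_fun fun lam => ?_)
    rw [map_smul, toLp_rep, map_smul, Complex.ofReal_inv]
    rfl
  rw [← h3]
  exact BoundedContinuousFunction.coeFn_toLp (p := 2) p.μ ℂ (J φ)

include hK

theorem hasDerivWithinAt_rep (hA : IsPositive p) (φ : H p) {z : ℝ} (hz : z ∈ Icc 0 p.ℓ) :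
    HasDerivWithinAt (J (R φ)) (K φ z) (Icc 0 p.ℓ) z := by
  -- J and R each carry a factor λ^{-1/2}. Their product λ⁻¹ matches the coefficients of K, so the
  -- integral identity for each eigenvector can be summed term by term.
  have hsum : HasSum
      (fun lam : ℝ => (lam⁻¹ : ℂ) • rep p (toGraph p lam (eigencomp hα lam φ))) (J (R φ)) := by
    refine (hJ (R φ)).congr_fun fun lam => ?_
    have h1 : eigencomp hα lam (R φ) = (((Real.sqrt lam)⁻¹ : ℝ) : ℂ) • eigencomp hα lam φ :=
      Subtype.ext (eigenproj_hasSum hα (hR φ) lam)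
    rw [h1, map_smul, map_smul, smul_smul]
    by_cases h : eigenspaceA p lam = ⊥
    · have h0 : eigencomp hα lam φ = 0 := Subtype.ext (eigenproj_eq_zero hα h φ)
      simp [h0]
    · obtain ⟨x, hx, hx0⟩ := Submodule.exists_mem_ne_zero_of_ne_bot h
      have hl := hA.pos hx hx0
      congr 1
      rw [Complex.ofReal_inv, ← mul_inv, ← Complex.ofReal_mul, Real.mul_self_sqrt hl.le]
  have hint : ∀ y ∈ Icc 0 p.ℓ, J (R φ) y = J (R φ) 0 + ∫ t in (0 : ℝ)..y, K φ t := by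
    intro y hy
    have s1 := hsum.mapL (BoundedContinuousFunction.evalCLM ℂ y)
    have s2 := (hsum.mapL (BoundedContinuousFunction.evalCLM ℂ (0 : ℝ))).add
      ((hK φ).mapL (integralL y))
    refine s1.unique (s2.congr_fun fun lam => ?_)
    simp only [map_smul, BoundedContinuousFunction.evalCLM_apply, integralL_apply]
    rw [rep_eq_integral _ hy, smul_add]
  have hd : HasDerivAt (fun y => J (R φ) 0 + ∫ t in (0 : ℝ)..y, K φ t) (K φ z) z :=
    (((K φ).continuous.integral_hasStrictDerivAt 0 z).hasDerivAt).const_add _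
  exact hd.hasDerivWithinAt.congr hint (hint z hz)

end Representatives

/-! ### Test functions under √A -/

section TestFunction

variable {f : ℝ → H p}

theorem hasSum_sqrt (hα : p.α ≠ 0) {φ : H p} (h : φ ∈ sqrtDomain p) :
    HasSum (fun lam => (Real.sqrt lam : ℂ) • eigenproj p lam φ) (funA p Real.sqrt φ) :=
  (summable_smul_eigenproj hα h).hasSum

theorem IsTestFunction.continuous_funA_sqrt (hα : p.α ≠ 0) (hf : IsTestFunction p f) :
    Continuous fun t => funA p Real.sqrt (f t) := by
  rw [continuous_iff_continuousAt]
  intro t₀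
  have e : ∀ t, funA p Real.sqrt (f t - f t₀) =
      funA p Real.sqrt (f t) - funA p Real.sqrt (f t₀) := by
    intro t
    refine (((hasSum_sqrt hα (hf.mem_domain t)).sub
      (hasSum_sqrt hα (hf.mem_domain t₀))).congr_fun fun lam => ?_).tsum_eq
    rw [map_sub, smul_sub]
  refine tendsto_iff_norm_sub_tendsto_zero.mpr ?_
  refine squeeze_zero (fun _ => norm_nonneg _) (fun t => ?_) (hf.continuous_graphNorm t₀)
  rw [← e, graphNorm]
  exact le_add_of_nonneg_left (norm_nonneg _)

theorem IsTestFunction.hasCompactSupport_funA_sqrt (hf : IsTestFunction p f) :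
    HasCompactSupport fun t => funA p Real.sqrt (f t) :=
  hf.compact_support.comp_left (g := funA p Real.sqrt) (by simp [funA])

end TestFunction

end DynBC

end

/-! ### The regularity theorem -/

open DynBC in
theorem mainTheorem5 (p : DynBC.Params) (hα : p.α ≠ 0) (hA : DynBC.IsPositive p)
    (f : ℝ → DynBC.H p) (hf : DynBC.IsTestFunction p f) :
    ∃ (u ut uz : ℝ → ℝ → ℂ) (v vt : ℝ → ℂ),
      -- `φ_f(t) = (u(t, ·), v(t))` for every `t`
      (∀ t, DynBC.bulk (DynBC.solution p f t) =ᵐ[p.μ] u t) ∧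
      (∀ t, DynBC.bdry (DynBC.solution p f t) = v t) ∧
      -- the first component is continuously differentiable in `t` and `z`
      (∀ t, ∀ z ∈ Icc 0 p.ℓ, HasDerivAt (fun s => u s z) (ut t z) t) ∧
      (∀ t, ∀ z ∈ Icc 0 p.ℓ, HasDerivWithinAt (u t) (uz t z) (Icc 0 p.ℓ) z) ∧
      ContinuousOn (Function.uncurry ut) (univ ×ˢ Icc 0 p.ℓ) ∧
      ContinuousOn (Function.uncurry uz) (univ ×ˢ Icc 0 p.ℓ) ∧
      -- the second component is continuously differentiable in `t`
      (∀ t, HasDerivAt v (vt t) t) ∧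
      Continuous vt ∧
      -- the derivatives are uniformly bounded
      ∃ C : ℝ, ∀ t, ∀ z ∈ Icc 0 p.ℓ, ‖ut t z‖ ≤ C ∧ ‖uz t z‖ ≤ C ∧ ‖vt t‖ ≤ C := by
  obtain ⟨lam₀, hpos, hgap⟩ := spectral_gap hα hA
  obtain ⟨J, hJ⟩ := exists_rep_clm hα hA
  obtain ⟨K, hK⟩ := exists_repDeriv_clm hα hA
  -- R is A^{-1/2}; S and Q below are the sine and cosine of √A t.
  obtain ⟨R, hR, -⟩ := exists_isFun (g := fun lam => (Real.sqrt lam)⁻¹) hα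
    (M := (Real.sqrt lam₀)⁻¹) (by positivity) fun lam hl => by
      rw [abs_of_nonneg (by positivity)]
      exact inv_anti₀ (Real.sqrt_pos.mpr hpos) (Real.sqrt_le_sqrt (hgap lam hl))
  choose S hS hSn using fun t : ℝ => exists_isFun (g := fun lam => Real.sin (Real.sqrt lam * t)) hα
    zero_le_one fun lam _ => Real.abs_sin_le_one _
  choose Q hQ hQn using fun t : ℝ => exists_isFun (g := fun lam => Real.cos (Real.sqrt lam * t)) hα
    zero_le_one fun lam _ => Real.abs_cos_le_one _
  simp only [one_mul] at hSn hQn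
  have hSc : ∀ φ, Continuous fun t => S t φ :=
    continuous_apply hα hS hSn fun lam => by fun_prop
  have hQc : ∀ φ, Continuous fun t => Q t φ :=
    continuous_apply hα hQ hQn fun lam => by fun_prop
  have hsqrt : ∀ lam, eigenspaceA p lam ≠ ⊥ → Real.sqrt lam ≠ 0 := fun lam hl =>
    (Real.sqrt_pos.mpr (hpos.trans_le (hgap lam hl))).ne'
  have hSd : ∀ φ t, HasDerivAt (fun t => R (S t φ)) (Q t φ) t := fun φ t =>
    hasDerivAt_apply hα hQ hQn φ (fun t => hR.comp_apply hα (hS t φ)) (fun lam hl t => by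
      have h0 := hsqrt lam hl
      have h1 := (((hasDerivAt_id t).const_mul (Real.sqrt lam)).sin).const_mul (Real.sqrt lam)⁻¹
      refine h1.congr_deriv ?_
      simp only [id_eq, mul_one]
      field_simp) t
  have hQd : ∀ φ t, HasDerivAt (fun t => R (Q t φ)) (-S t φ) t := fun φ t => by
    -- The minus sign from differentiating the cosine is moved onto φ, so that the derivative is the
    -- sine operator applied to -φ.
    have := hasDerivAt_apply hα hS hSn (-φ) (g := fun t lam =>
      -((Real.sqrt lam)⁻¹ * Real.cos (Real.sqrt lam * t))) (G := fun t => R (Q t φ))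
      (fun t => (hR.comp_apply hα (hQ t φ)).congr_fun fun lam => by simp)
      (fun lam hl t => by
        have h0 := hsqrt lam hl
        have h1 := ((((hasDerivAt_id t).const_mul (Real.sqrt lam)).cos).const_mul
          (Real.sqrt lam)⁻¹).neg
        refine h1.congr_deriv ?_
        simp only [id_eq, mul_one]
        field_simp) t
    rwa [map_neg] at this
  set g : ℝ → H p := fun t => funA p Real.sqrt (f t) with hg
  have hgc : Continuous g := hf.continuous_funA_sqrt hα
  have hgs : HasCompactSupport g := hf.hasCompactSupport_funA_sqrt
  have hint : ∀ G : ℝ → H p →L[ℂ] H p, (∀ t φ, ‖G t φ‖ ≤ ‖φ‖) → (∀ φ, Continuous fun t => G t φ) →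
      Integrable fun t => G t (g t) := fun G hn hc =>
    (continuous_apply_apply hn hc hgc).integrable_of_hasCompactSupport
      (hgs.mono fun t ht h0 => ht (by simp only at h0 ⊢; rw [h0, map_zero]))
  have iS := hint S hSn hSc
  have iQ := hint Q hQn hQc
  set a := ∫ t, Q t (g t) with ha
  set b := ∫ t, S t (g t) with hb
  -- Writing λ^{-1/2} = λ⁻¹ √λ, with √λ absorbed in g, gains the extra half power of A⁻¹ that
  -- differentiation in z requires.
  have hprop : ∀ t t', propagator p (t - t') (f t') =
      -R (R (S t (Q t' (g t')) - Q t (S t' (g t')))) := by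
    intro t t'
    have hs := hasSum_sqrt hα (hf.mem_domain t')
    have h1 := hR.comp_apply hα (hR.comp_apply hα ((hS t).comp_apply hα
      ((hQ t').comp_apply hα hs)))
    have h2 := hR.comp_apply hα (hR.comp_apply hα ((hQ t).comp_apply hα
      ((hS t').comp_apply hα hs)))
    rw [map_sub, map_sub]
    refine ((h1.sub h2).neg.congr_fun fun lam => ?_).tsum_eq
    by_cases h : eigenspaceA p lam = ⊥
    · simp [eigenproj_eq_zero hα h]
    · have h0 := hsqrt lam h
      rw [← sub_smul, ← neg_smul]
      congr 1
      rw [← Complex.ofReal_sub, ← Complex.ofReal_neg]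
      congr 1
      simp only [mul_sub, Real.sin_sub]
      field_simp
  have hsol : ∀ t, solution p f t = -R (R (S t a - Q t b)) := by
    intro t
    have h1 : ∫ t', S t (Q t' (g t')) = S t a := (S t).integral_comp_comm iQ
    have h2 : ∫ t', Q t (S t' (g t')) = Q t b := (Q t).integral_comp_comm iS
    have i1 := (S t).integrable_comp iQ
    have i2 := (Q t).integrable_comp iS
    have h3 := ((-(R.comp R)).integral_comp_comm (i1.sub i2))
    rw [← h1, ← h2, ← integral_sub i1 i2]
    rw [solution]
    simp_rw [hprop]
    exact h3
  set Φ : ℝ → H p := fun t => -(S t a - Q t b) with hΦ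
  set Ψ : ℝ → H p := fun t => -(Q t a + S t b) with hΨ
  have hΦc : Continuous Φ := ((hSc a).sub (hQc b)).neg
  have hΨc : Continuous Ψ := ((hQc a).add (hSc b)).neg
  have hΦn : ∀ t, ‖Φ t‖ ≤ ‖a‖ + ‖b‖ := fun t => by
    rw [hΦ, norm_neg]
    exact (norm_sub_le _ _).trans (add_le_add (hSn t a) (hQn t b))
  have hΨn : ∀ t, ‖Ψ t‖ ≤ ‖a‖ + ‖b‖ := fun t => by
    rw [hΨ, norm_neg]
    exact (norm_add_le _ _).trans (add_le_add (hQn t a) (hSn t b))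
  have hsol' : ∀ t, solution p f t = R (R (Φ t)) := fun t => by
    rw [hsol, hΦ, map_neg, map_neg]
  have hd : ∀ t, HasDerivAt (fun t => R (Φ t)) (Ψ t) t := fun t => by
    have h1 := ((hSd a t).sub (hQd b t)).neg
    rw [sub_neg_eq_add] at h1
    refine h1.congr_of_eventuallyEq (Filter.Eventually.of_forall fun s => ?_)
    simp [hΦ]
  -- Evaluation is jointly continuous for the sup norm; this upgrades continuity in t to joint
  -- continuity in (t, z).
  have hev : Continuous fun q : (ℝ →ᵇ ℂ) × ℝ => q.1 q.2 := by fun_prop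
  refine ⟨fun t z => J (R (Φ t)) z, fun t z => J (Ψ t) z, fun t z => K (Φ t) z,
    fun t => bdry (R (R (Φ t))), fun t => bdry (R (Ψ t)), ?_, ?_, ?_, ?_, ?_, ?_, ?_, ?_, ?_⟩
  · intro t
    rw [hsol']
    exact bulk_ae_eq hα hJ hR _
  · intro t
    rw [hsol']
  · intro t z _
    exact (((BoundedContinuousFunction.evalCLM ℂ z).comp J).restrictScalars ℝ).hasFDerivAt
      |>.comp_hasDerivAt t (hd t)
  · intro t z hz
    exact hasDerivWithinAt_rep hα hJ hK hR hA _ hz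
  · exact (hev.comp (((J.continuous.comp hΨc).comp continuous_fst).prodMk
      continuous_snd)).continuousOn
  · exact (hev.comp (((K.continuous.comp hΦc).comp continuous_fst).prodMk
      continuous_snd)).continuousOn
  · intro t
    exact (((bdryL p).comp R).restrictScalars ℝ).hasFDerivAt.comp_hasDerivAt t (hd t)
  · exact ((bdryL p).comp R).continuous.comp hΨc
  · refine ⟨(‖J‖ + ‖K‖ + ‖(bdryL p).comp R‖) * (‖a‖ + ‖b‖), fun t z _ => ⟨?_, ?_, ?_⟩⟩
    · refine ((J (Ψ t)).norm_coe_le_norm z).trans ((J.le_opNorm _).trans ?_)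
      gcongr
      · linarith [norm_nonneg K, norm_nonneg ((bdryL p).comp R)]
      · exact hΨn t
    · refine ((K (Φ t)).norm_coe_le_norm z).trans ((K.le_opNorm _).trans ?_)
      gcongr
      · linarith [norm_nonneg J, norm_nonneg ((bdryL p).comp R)]
      · exact hΦn t
    · refine (((bdryL p).comp R).le_opNorm (Ψ t)).trans ?_
      gcongr
      · linarith [norm_nonneg J, norm_nonneg K]
      · exact hΨn t
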